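/- **The type theory CaTT.** Variables are $x_0,x_1,\dots$; expressions are taken up to renaming of variables. Raw types are $\star$ and $t\to_A u$, where $A$ is a type and $t,u$ are terms. Raw terms are variables and $\mathsf{op}_{\Gamma,A}[\gamma]$, $\mathsf{coh}_{\Gamma,A}[\gamma]$, where $\Gamma$ is a context, $A$ a type and $\gamma$ a substitution. Contexts are lists $(x_i:A_i)_i$, and substitutions are lists $\langle x_i\mapsto t_i\rangle_i$. Substitutions act on expressions in the usual way, with $\mathsf{op}_{\Gamma,A}[\gamma][\delta]=\mathsf{op}_{\Gamma,A}[\gamma\circ\delta]$ and similarly for $\mathsf{coh}$. $\mathrm{Var}(E)$ is the set of variables of an expression $E$, where $\mathrm{Var}(\mathsf{op}_{\Gamma,A}[\gamma])=\mathrm{Var}(\mathsf{coh}_{\Gamma,A}[\gamma])=\mathrm{Var}(\gamma)$, the union of the sets of variables of the terms of $\gamma$. Put $\dim\star=0$, $\dim(t\to_A u)=\dim A+1$, and let $\dim\Gamma$ be the maximal dimension of the types in $\Gamma$. *Ps-contexts.* The judgments $\Gamma\vdash_{ps}x:A$ and $\Gamma\vdash_{ps}$ are generated by: $(x:\star)\vdash_{ps}x:\star$;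 if $\Gamma\vdash_{ps}f:x\to_A y$ then $\Gamma\vdash_{ps}y:A$; if $\Gamma\vdash_{ps}x:A$ then $(\Gamma,y:A,f:x\to_A y)\vdash_{ps}f:x\to_A y$; if $\Gamma\vdash_{ps}x:\star$ then $\Gamma\vdash_{ps}$. The $i$-source and $i$-target of a ps-context are given by $\partial^\pm_i(x:\star)=(x:\star)$, by $\partial_i^-(\Gamma,y:A,f:x\to_A y)=\partial_i^-\Gamma$ if $\dim A\ge i$ and $(\partial_i^-\Gamma,y:A,f:x\to_A y)$ otherwise, and by $\partial_i^+(\Gamma,y:A,f:x\to_A y)=\partial_i^+\Gamma$ if $\dim A>i$, $(\partial_i^+\Gamma$ without its last variable$,\,y:A)$ if $\dim A=i$, and $(\partial_i^+\Gamma,y:A,f:x\to_A y)$ otherwise. If $\dim\Gamma\geq 1$, put $\partial^\pm\Gamma=\partial^\pm_{\dim\Gamma-1}\Gamma$. *Rules.* $\emptyset\vdash$; if $\Gamma\vdash A$ then $(\Gamma,x:A)\vdash$ for $x$ fresh; if $\Gamma\vdash$ then $\Gamma\vdash\star$; if $\Gamma\vdash t:A$ and $\Gamma\vdash u:A$ then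 $\Gamma\vdash t\to_A u$; if $\Gamma\vdash$ and $(x:A)\in\Gamma$ then $\Gamma\vdash x:A$; if $\Delta\vdash$ then $\Delta\vdash\langle\rangle:\emptyset$; if $\Delta\vdash\gamma:\Gamma$, $\Gamma\vdash A$ and $\Delta\vdash t:A[\gamma]$ then $\Delta\vdash\langle\gamma,x\mapsto t\rangle:(\Gamma,x:A)$. Given $\Gamma\vdash_{ps}$, $\Gamma\vdash t:A$ and $\Gamma\vdash u:A$: one has $\Gamma\vdash_{op}t\to_A u$ if $\dim\Gamma\ge1$, $\mathrm{Var}(t)\cup\mathrm{Var}(A)=\mathrm{Var}(\partial^-\Gamma)$ and $\mathrm{Var}(u)\cup\mathrm{Var}(A)=\mathrm{Var}(\partial^+\Gamma)$; and $\Gamma\vdash_{coh}t\to_A u$ if $\mathrm{Var}(t)\cup\mathrm{Var}(A)=\mathrm{Var}(u)\cup\mathrm{Var}(A)=\mathrm{Var}(\Gamma)$. If $\Gamma\vdash_{op}A$ (resp. $\Gamma\vdash_{coh}A$) and $\Delta\vdash\gamma:\Gamma$, then $\Delta\vdash\mathsf{op}_{\Gamma,A}[\gamma]:A[\gamma]$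 (resp. $\Delta\vdash\mathsf{coh}_{\Gamma,A}[\gamma]:A[\gamma]$). **The type theory MCaTT.** Raw types are $\mathbf 1$ and $t\to_A u$; raw terms are variables, $()$, and $\mathsf{mop}_{\Gamma,A}[\gamma]$, $\mathsf{mcoh}_{\Gamma,A}[\gamma]$, where $\Gamma$ and $A$ are a context and a type *of CaTT* and $\gamma$ is a substitution of MCaTT. The *desuspension* $\downarrow$ from raw CaTT to raw MCaTT replaces $\star$ by $\mathbf 1$, $\mathsf{op}_{\Gamma,A}[\gamma]$ by $\mathsf{mop}_{\Gamma,A}[\downarrow\gamma]$ and $\mathsf{coh}_{\Gamma,A}[\gamma]$ by $\mathsf{mcoh}_{\Gamma,A}[\downarrow\gamma]$, and commutes with all other constructors. The rules for contexts, variables and substitutions are as in CaTT. Moreover, if $\Gamma\vdash$ then $\Gamma\vdash\mathbf 1$ and $\Gamma\vdash():\mathbf 1$; if $\Gamma\vdash A$, $\Gamma\vdash t:A$ and $\Gamma\vdash u:A$ then $\Gamma\vdash t\to_A u$; if $\Gamma\vdash_{op}A$ (resp. $\Gamma\vdash_{coh}A$) in CaTT and $\Delta\vdash\gamma:\downarrow\Gamma$,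 then $\Delta\vdash\mathsf{mop}_{\Gamma,A}[\gamma]:(\downarrow A)[\gamma]$ (resp. $\Delta\vdash\mathsf{mcoh}_{\Gamma,A}[\gamma]:(\downarrow A)[\gamma]$). Definitional equality $\equiv$ is the congruence generated by $t\equiv u:\mathbf 1$ whenever $\Gamma\vdash t:\mathbf 1$ and $\Gamma\vdash u:\mathbf 1$, and if $\Gamma\vdash t:A$ and $\Gamma\vdash A\equiv B$ then $\Gamma\vdash t:B$. Every derivable expression has a normal form, which is obtained by replacing the variables of type $\mathbf 1$ by $()$. **Syntactic categories.** The objects of $\mathrm{Syn}(\mathrm{CaTT})$ are the derivable contexts, and its morphisms $\Delta\to\Gamma$ are the substitutions $\Delta\vdash\gamma:\Gamma$. $\mathrm{Syn}(\mathrm{MCaTT})$ is defined in the same way, with contexts and substitutions up to definitional equality, that is, in normal form. Display maps are the projections $(\Gamma,x:A)\to\Gamma$. A *model* of one of these categories is a functor from it to $\mathrm{Set}$ that preserves the terminal object and sends pullbacks along display maps to pullbacks; morphisms of models are natural transformations. Let $\mathrm{Mod}_\bullet(\mathrm{Syn}(\mathrm{CaTT}))$ be the full subcategory of the models $F$ of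 $\mathrm{Syn}(\mathrm{CaTT})$ with exactly one $0$-cell, i.e. such that $F(x:\star)$ is a singleton. **The functors.** Desuspension induces a functor $\downarrow:\mathrm{Syn}(\mathrm{CaTT})\to\mathrm{Syn}(\mathrm{MCaTT})$. The *reduced suspension* $\uparrow:\mathrm{Syn}(\mathrm{MCaTT})\to\mathrm{Syn}(\mathrm{CaTT})$ is the functor defined on normal forms, with a fresh variable $\bullet$, by $\uparrow\emptyset=(\bullet:\star)$, $\uparrow(\Gamma,x:\mathbf 1)=\uparrow\Gamma$ and $\uparrow(\Gamma,x:A)=(\uparrow\Gamma,x:\uparrow A)$ for $A\ne\mathbf 1$; $\uparrow\mathbf 1=\star$ and $\uparrow(t\to_Au)=(\uparrow t)\to_{\uparrow A}(\uparrow u)$; $\uparrow()=\bullet$, $\uparrow x=x$, $\uparrow\mathsf{mop}_{\Theta,A}[\gamma]=\mathsf{op}_{\Theta,A}[\bullet_\Theta\circ\uparrow\gamma]$ and $\uparrow\mathsf{mcoh}_{\Theta,A}[\gamma]=\mathsf{coh}_{\Theta,A}[\bullet_\Theta\circ\uparrow\gamma]$; $\uparrow\langle\rangle=\langle\bullet\mapsto\bullet\rangle$,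 and $\uparrow\langle\gamma,x\mapsto t\rangle$ is $\uparrow\gamma$ if $x:\mathbf 1$ and $\langle\uparrow\gamma,x\mapsto\uparrow t\rangle$ otherwise. Here $\bullet_\Theta:\uparrow\downarrow\Theta\to\Theta$ is the substitution that maps each variable $x$ of $\Theta$ to $\bullet$ if $x$ has type $\star$ and to $x$ otherwise. **Theorem.** Precomposition with $\downarrow$ and precomposition with $\uparrow$ restrict to functors $$\downarrow^*:\mathrm{Mod}(\mathrm{Syn}(\mathrm{MCaTT}))\to\mathrm{Mod}_\bullet(\mathrm{Syn}(\mathrm{CaTT})),\qquad \uparrow^*:\mathrm{Mod}_\bullet(\mathrm{Syn}(\mathrm{CaTT}))\to\mathrm{Mod}(\mathrm{Syn}(\mathrm{MCaTT})),$$ and these two functors are the two directions of an equivalence of categories. -/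

import Mathlib

open CategoryTheory CategoryTheory.Limits

/-- Extend a list `f` of length `n` by a last entry `x`. -/
def snocFun {X : Type*} {n : ℕ} (f : Fin n → X) (x : X) : Fin (n + 1) → X :=
  Fin.lastCases (motive := fun _ => X) x f

@[simp] theorem snocFun_last {X : Type*} {n : ℕ} (f : Fin n → X) (x : X) :
    snocFun f x (Fin.last n) = x := by simp [snocFun]

@[simp] theorem snocFun_castSucc {X : Type*} {n : ℕ} (f : Fin n → X) (x : X) (i : Fin n) :
    snocFun f x i.castSucc = f i := by simp [snocFun]

theorem comp_snocFun {X Y : Type*} {n : ℕ} (g : X → Y) (f : Fin n → X) (x : X) :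
    (fun i => g (snocFun f x i)) = snocFun (fun i => g (f i)) (g x) := by
  funext i
  refine Fin.lastCases ?_ (fun j => ?_) i <;> simp

/-! ## The type theory CaTT

The syntax is nameless: the variables of a context of length `n` are the elements of `Fin n`, the
variable `i` being the one that is declared at position `i`. Weakening does not change positions.
A raw substitution from a context of length `m` to one of length `n` is a list of `n` terms over
`m` variables, that is a function `Fin n → Tm m`. -/

namespace CaTT

/-- The two kinds of term constructors: operations and coherences. -/
inductive Kind : Type
  | op
  | coh

mutual

/-- Raw contexts of length `n`. -/
inductive Ctx : ℕ → Type
  | nil : Ctx 0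
  | snoc {n : ℕ} (Γ : Ctx n) (A : Ty n) : Ctx (n + 1)

/-- Raw types over `n` variables: `⋆`, and the type of arrows from `t` to `u` over `A`. -/
inductive Ty : ℕ → Type
  | obj {n : ℕ} : Ty n
  | hom {n : ℕ} (A : Ty n) (t u : Tm n) : Ty n

/-- Raw terms over `n` variables: variables, and `op_{Γ,A}[γ]`, `coh_{Γ,A}[γ]`. -/
inductive Tm : ℕ → Type
  | var {n : ℕ} (i : Fin n) : Tm n
  | constr {n : ℕ} (c : Kind) {k : ℕ} (Γ : Ctx k) (A : Ty k) (γ : Fin k → Tm n) : Tm n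

end

/-- The action of a substitution on a term. -/
def Tm.subst {m n : ℕ} (σ : Fin n → Tm m) : Tm n → Tm m
  | .var i => σ i
  | .constr c Γ A γ => .constr c Γ A (fun i => (γ i).subst σ)

/-- The action of a substitution on a type. -/
def Ty.subst {m n : ℕ} (σ : Fin n → Tm m) : Ty n → Ty m
  | .obj => .obj
  | .hom A t u => .hom (A.subst σ) (t.subst σ) (u.subst σ)

/-- The weakening (projection) substitution of a context extended by one variable. -/
def wk {n : ℕ} : Fin n → Tm (n + 1) := fun i => .var i.castSucc

/-- The declared type of a variable, as a type over the whole context. -/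
def Ctx.get : {n : ℕ} → Ctx n → Fin n → Ty n
  | _, .nil => Fin.elim0
  | _, .snoc Γ A => snocFun (fun i => (Γ.get i).subst wk) (A.subst wk)

/-- The set of variables of a term. -/
def Tm.vars {n : ℕ} : Tm n → Set (Fin n)
  | .var i => {i}
  | .constr _ _ _ γ => ⋃ i, (γ i).vars

/-- The set of variables of a type. -/
def Ty.vars {n : ℕ} : Ty n → Set (Fin n)
  | .obj => ∅
  | .hom A t u => A.vars ∪ t.vars ∪ u.vars

/-- The dimension of the cells of a given type: `0` for `⋆`. -/
def Ty.dim {n : ℕ} : Ty n → ℕ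
  | .obj => 0
  | .hom A _ _ => A.dim + 1

/-- The dimension of a context: the highest dimension of its variables. -/
def Ctx.dim : {n : ℕ} → Ctx n → ℕ
  | _, .nil => 0
  | _, .snoc Γ A => max Γ.dim A.dim

/-- `PsD Γ x A` is the judgment `Γ ⊢ps x : A`. -/
inductive PsD : {n : ℕ} → Ctx n → Fin n → Ty n → Prop
  | pss : PsD (.snoc .nil .obj) (Fin.last 0) .obj
  | psd {n : ℕ} {Γ : Ctx n} {f x y : Fin n} {A : Ty n} :
      PsD Γ f (.hom A (.var x) (.var y)) → PsD Γ y A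
  | pse {n : ℕ} {Γ : Ctx n} {x : Fin n} {A : Ty n} :
      PsD Γ x A →
      PsD ((Γ.snoc A).snoc (.hom (A.subst wk) (.var x.castSucc) (.var (Fin.last n))))
        (Fin.last (n + 1))
        (Ty.subst wk (.hom (A.subst wk) (.var x.castSucc) (.var (Fin.last n))))

/-- `Ps Γ` is the judgment `Γ ⊢ps`: the context `Γ` is a ps-context. -/
def Ps {n : ℕ} (Γ : Ctx n) : Prop := ∃ x, PsD Γ x .obj

/-- The variables of the `i`-source of a ps-context, the latest first. -/
def Ctx.src (i : ℕ) : {n : ℕ} → Ctx n → List (Fin n)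
  | _, .nil => []
  | _, .snoc .nil _ => [0]
  | _, .snoc (n := n + 1) (.snoc Γ A) _ =>
      let old := (Ctx.src i Γ).map (fun j => j.castSucc.castSucc)
      let y : Fin (n + 2) := (Fin.last n).castSucc
      let f : Fin (n + 2) := Fin.last (n + 1)
      if i ≤ A.dim then old else f :: y :: old

/-- The variables of the `i`-target of a ps-context, the latest first; `List.tail` removes the
latest one. -/
def Ctx.tgt (i : ℕ) : {n : ℕ} → Ctx n → List (Fin n)
  | _, .nil => []
  | _, .snoc .nil _ => [0]
  | _, .snoc (n := n + 1) (.snoc Γ A) _ =>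
      let old := (Ctx.tgt i Γ).map (fun j => j.castSucc.castSucc)
      let y : Fin (n + 2) := (Fin.last n).castSucc
      let f : Fin (n + 2) := Fin.last (n + 1)
      if i < A.dim then old else if i = A.dim then y :: old.tail else f :: y :: old

/-- The judgments of CaTT. `valid .op Γ A` and `valid .coh Γ A` state that `A` defines a valid
operation, respectively a valid coherence, in the ps-context `Γ`. -/
inductive Judgment : Type
  | ctx {n : ℕ} (Γ : Ctx n)
  | ty {n : ℕ} (Γ : Ctx n) (A : Ty n)
  | tm {n : ℕ} (Γ : Ctx n) (t : Tm n) (A : Ty n)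
  | sub {m n : ℕ} (Δ : Ctx m) (γ : Fin n → Tm m) (Γ : Ctx n)
  | valid (c : Kind) {n : ℕ} (Γ : Ctx n) (A : Ty n)

open Judgment in
/-- The derivable judgments of CaTT. The source and target of a ps-context `Γ` are its `i`-source
and `i`-target for `i + 1 = dim Γ`; they are not defined when `dim Γ = 0`. -/
inductive Derivable : Judgment → Prop
  | ec : Derivable (ctx .nil)
  | ce {n : ℕ} {Γ : Ctx n} {A : Ty n} :
      Derivable (ty Γ A) → Derivable (ctx (Γ.snoc A))
  | obj_intro {n : ℕ} {Γ : Ctx n} :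
      Derivable (ctx Γ) → Derivable (ty Γ .obj)
  | hom_intro {n : ℕ} {Γ : Ctx n} {A : Ty n} {t u : Tm n} :
      Derivable (tm Γ t A) → Derivable (tm Γ u A) → Derivable (ty Γ (.hom A t u))
  | var {n : ℕ} {Γ : Ctx n} (i : Fin n) :
      Derivable (ctx Γ) → Derivable (tm Γ (.var i) (Γ.get i))
  | valid_op {n : ℕ} {Γ : Ctx n} {A : Ty n} {t u : Tm n} {i : ℕ} :
      Ps Γ → Γ.dim = i + 1 → Derivable (tm Γ t A) → Derivable (tm Γ u A) →
      t.vars ∪ A.vars = {x | x ∈ Γ.src i} → u.vars ∪ A.vars = {x | x ∈ Γ.tgt i} →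
      Derivable (valid .op Γ (.hom A t u))
  | valid_coh {n : ℕ} {Γ : Ctx n} {A : Ty n} {t u : Tm n} :
      Ps Γ → Derivable (tm Γ t A) → Derivable (tm Γ u A) →
      t.vars ∪ A.vars = Set.univ → u.vars ∪ A.vars = Set.univ →
      Derivable (valid .coh Γ (.hom A t u))
  | constr_intro {m n : ℕ} {Δ : Ctx m} {Γ : Ctx n} {c : Kind} {A : Ty n} {γ : Fin n → Tm m} :
      Derivable (valid c Γ A) → Derivable (sub Δ γ Γ) →
      Derivable (tm Δ (.constr c Γ A γ) (A.subst γ))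
  | es {m : ℕ} {Δ : Ctx m} {γ : Fin 0 → Tm m} :
      Derivable (ctx Δ) → Derivable (sub Δ γ .nil)
  | se {m n : ℕ} {Δ : Ctx m} {Γ : Ctx n} {γ : Fin n → Tm m} {A : Ty n} {t : Tm m} :
      Derivable (sub Δ γ Γ) → Derivable (ty Γ A) → Derivable (tm Δ t (A.subst γ)) →
      Derivable (sub Δ (snocFun γ t) (Γ.snoc A))

/-! ### Properties of substitution -/

theorem Tm.subst_subst {l m n : ℕ} (σ : Fin n → Tm m) (τ : Fin m → Tm l) :
    ∀ t : Tm n, (t.subst σ).subst τ = t.subst (fun i => (σ i).subst τ)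
  | .var _ => rfl
  | .constr c Γ A γ => by
      simp only [Tm.subst]
      congr 1
      funext i
      exact Tm.subst_subst σ τ (γ i)

theorem Ty.subst_subst {l m n : ℕ} (σ : Fin n → Tm m) (τ : Fin m → Tm l) :
    ∀ A : Ty n, (A.subst σ).subst τ = A.subst (fun i => (σ i).subst τ)
  | .obj => rfl
  | .hom A t u => by
      simp only [Ty.subst, Tm.subst_subst, Ty.subst_subst σ τ A]

theorem Tm.subst_id {n : ℕ} : ∀ t : Tm n, t.subst .var = t
  | .var _ => rfl
  | .constr c Γ A γ => by
      simp only [Tm.subst]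
      congr 1
      funext i
      exact Tm.subst_id (γ i)

theorem Ty.subst_id {n : ℕ} : ∀ A : Ty n, A.subst .var = A
  | .obj => rfl
  | .hom A t u => by simp only [Ty.subst, Tm.subst_id, Ty.subst_id A]

theorem Ty.subst_wk_snoc {m n : ℕ} (γ : Fin n → Tm m) (t : Tm m) (A : Ty n) :
    (A.subst wk).subst (snocFun γ t) = A.subst γ := by
  rw [Ty.subst_subst]
  congr 1
  funext i
  simp [wk, Tm.subst]

theorem Ctx.get_last {n : ℕ} (Γ : Ctx n) (A : Ty n) :
    (Γ.snoc A).get (Fin.last n) = A.subst wk := by simp [Ctx.get]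

theorem Ctx.get_castSucc {n : ℕ} (Γ : Ctx n) (A : Ty n) (i : Fin n) :
    (Γ.snoc A).get i.castSucc = (Γ.get i).subst wk := by simp [Ctx.get]

open Judgment

/-- What a derivable judgment presupposes. -/
def Presup : Judgment → Prop
  | ctx _ => True
  | ty Γ _ => Derivable (ctx Γ)
  | tm Γ _ _ => Derivable (ctx Γ)
  | sub Δ γ Γ => Derivable (ctx Δ) ∧ Derivable (ctx Γ) ∧
      ∀ i, Derivable (tm Δ (γ i) ((Γ.get i).subst γ))
  | valid _ Γ A => Derivable (ty Γ A)

theorem Derivable.presup {J : Judgment} (h : Derivable J) : Presup J := by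
  induction h with
  | ec => trivial
  | ce => trivial
  | obj_intro h => exact h
  | hom_intro _ _ ih _ => exact ih
  | var i h => exact h
  | valid_op _ _ h₁ h₂ => exact .hom_intro h₁ h₂
  | valid_coh _ h₁ h₂ => exact .hom_intro h₁ h₂
  | constr_intro _ _ _ ih => exact ih.1
  | es h => exact ⟨h, .ec, fun i => i.elim0⟩
  | se _ hA ht ih _ _ =>
      refine ⟨ih.1, .ce hA, fun i => ?_⟩
      refine Fin.lastCases ?_ (fun j => ?_) i
      · simpa [Ctx.get_last, Ty.subst_wk_snoc] using ht
      · simpa [Ctx.get_castSucc, Ty.subst_wk_snoc] using ih.2.2 j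

theorem Derivable.ty_of_ctx_snoc {n : ℕ} {Γ : Ctx n} {A : Ty n}
    (h : Derivable (ctx (Γ.snoc A))) : Derivable (ty Γ A) := by
  cases h with
  | ce h => exact h

theorem eq_snocFun {X : Type*} {n : ℕ} (f : Fin (n + 1) → X) :
    f = snocFun (fun i => f i.castSucc) (f (Fin.last n)) := by
  funext i
  refine Fin.lastCases ?_ (fun j => ?_) i <;> simp

theorem Derivable.sub_of_forall {m : ℕ} {Δ : Ctx m} (hΔ : Derivable (ctx Δ)) :
    ∀ {n : ℕ} {Γ : Ctx n} {γ : Fin n → Tm m}, Derivable (ctx Γ) →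
      (∀ i, Derivable (tm Δ (γ i) ((Γ.get i).subst γ))) → Derivable (sub Δ γ Γ)
  | _, .nil, _, _, _ => .es hΔ
  | _, .snoc Γ A, γ, hΓ, h => by
      have hA := hΓ.ty_of_ctx_snoc
      rw [eq_snocFun γ] at h ⊢
      refine .se (Derivable.sub_of_forall hΔ hA.presup fun i => ?_) hA ?_
      · simpa [Ctx.get_castSucc, Ty.subst_wk_snoc] using h i.castSucc
      · simpa [Ctx.get_last, Ty.subst_wk_snoc] using h (Fin.last _)

theorem Derivable.id {n : ℕ} {Γ : Ctx n} (h : Derivable (ctx Γ)) :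
    Derivable (sub Γ .var Γ) :=
  .sub_of_forall h h fun i => by simpa [Ty.subst_id] using Derivable.var i h

theorem Derivable.wk {n : ℕ} {Γ : Ctx n} {A : Ty n} (h : Derivable (ty Γ A)) :
    Derivable (sub (Γ.snoc A) wk Γ) :=
  .sub_of_forall (.ce h) h.presup fun i => by
    rw [← Ctx.get_castSucc Γ A]
    exact Derivable.var i.castSucc (.ce h)

/-- Admissibility of substitution. -/
def Stable : Judgment → Prop
  | ty Γ A => ∀ {m : ℕ} {Δ : Ctx m} {σ}, Derivable (sub Δ σ Γ) → Derivable (ty Δ (A.subst σ))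
  | tm Γ t A => ∀ {m : ℕ} {Δ : Ctx m} {σ}, Derivable (sub Δ σ Γ) →
      Derivable (tm Δ (t.subst σ) (A.subst σ))
  | sub Γ γ Θ => ∀ {m : ℕ} {Δ : Ctx m} {σ}, Derivable (sub Δ σ Γ) →
      Derivable (sub Δ (fun i => (γ i).subst σ) Θ)
  | _ => True

theorem Derivable.stable {J : Judgment} (h : Derivable J) : Stable J := by
  induction h with
  | ec => trivial
  | ce => trivial
  | obj_intro h => exact fun hσ => .obj_intro hσ.presup.1
  | hom_intro _ _ ih₁ ih₂ => exact fun hσ => .hom_intro (ih₁ hσ) (ih₂ hσ)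
  | var i h => exact fun hσ => hσ.presup.2.2 i
  | valid_op => trivial
  | valid_coh => trivial
  | constr_intro hv _ _ ih =>
      intro _ _ _ hσ
      rw [Ty.subst_subst]
      exact .constr_intro hv (ih hσ)
  | es h => exact fun hσ => .es hσ.presup.1
  | se _ hA _ ih₁ _ ih₂ =>
      intro _ _ σ hσ
      rw [comp_snocFun]
      refine .se (ih₁ hσ) hA ?_
      simpa only [Ty.subst_subst] using ih₂ hσ

/-- Objects of the syntactic category of CaTT: the derivable contexts. -/
structure Syn : Type where
  {len : ℕ}
  ctx : Ctx len
  ok : Derivable (.ctx ctx)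

/-- Morphisms of the syntactic category of CaTT: the derivable substitutions. -/
@[ext] structure Syn.Hom (Δ Γ : Syn) : Type where
  toFun : Fin Γ.len → Tm Δ.len
  ok : Derivable (.sub Δ.ctx toFun Γ.ctx)

instance : Category Syn where
  Hom := Syn.Hom
  id Γ := ⟨.var, Γ.ok.id⟩
  comp f g := ⟨fun i => (g.toFun i).subst f.toFun, g.ok.stable f.ok⟩
  id_comp f := Syn.Hom.ext (funext fun i => Tm.subst_id (f.toFun i))
  comp_id _ := rfl
  assoc f g h := Syn.Hom.ext (funext fun i => (Tm.subst_subst g.toFun f.toFun (h.toFun i)).symm)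

/-- The extended context `(Γ, x : A)`. -/
abbrev Syn.ext (Γ : Syn) (A : Ty Γ.len) (hA : Derivable (.ty Γ.ctx A)) : Syn :=
  ⟨Γ.ctx.snoc A, .ce hA⟩

/-- The projection `(Γ, x : A) ⟶ Γ`. -/
def Syn.proj (Γ : Syn) (A : Ty Γ.len) (hA : Derivable (.ty Γ.ctx A)) : Γ.ext A hA ⟶ Γ :=
  ⟨CaTT.wk, hA.wk⟩

/-- The display maps of the syntactic category of CaTT. -/
inductive displayMaps : MorphismProperty Syn
  | mk (Γ : Syn) (A : Ty Γ.len) (hA : Derivable (.ty Γ.ctx A)) : displayMaps (Γ.proj A hA)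

/-- The disk context `(x : ⋆)`. -/
def Syn.disk0 : Syn := ⟨.snoc .nil .obj, .ce (.obj_intro .ec)⟩

end CaTT

/-! ## The type theory MCaTT -/

namespace MCaTT

/-- Raw terms over `n` variables: `()`, variables, and `mop_{Γ,A}[γ]`, `mcoh_{Γ,A}[γ]`, where `Γ`
and `A` are a context and a type of CaTT. -/
inductive Tm (n : ℕ) : Type
  | star : Tm n
  | var (i : Fin n) : Tm n
  | constr (c : CaTT.Kind) {k : ℕ} (Γ : CaTT.Ctx k) (A : CaTT.Ty k) (γ : Fin k → Tm n) : Tm n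

/-- Raw types over `n` variables: the unit type, and the type of arrows from `t` to `u` over `A`. -/
inductive Ty (n : ℕ) : Type
  | unit : Ty n
  | hom (A : Ty n) (t u : Tm n) : Ty n

/-- Raw contexts of length `n`. -/
inductive Ctx : ℕ → Type
  | nil : Ctx 0
  | snoc {n : ℕ} (Γ : Ctx n) (A : Ty n) : Ctx (n + 1)

/-- The action of a substitution on a term. -/
def Tm.subst {m n : ℕ} (σ : Fin n → Tm m) : Tm n → Tm m
  | .star => .star
  | .var i => σ i
  | .constr c Γ A γ => .constr c Γ A (fun i => (γ i).subst σ)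

/-- The action of a substitution on a type. -/
def Ty.subst {m n : ℕ} (σ : Fin n → Tm m) : Ty n → Ty m
  | .unit => .unit
  | .hom A t u => .hom (A.subst σ) (t.subst σ) (u.subst σ)

/-- The weakening (projection) substitution of a context extended by one variable. -/
def wk {n : ℕ} : Fin n → Tm (n + 1) := fun i => .var i.castSucc

/-- The declared type of a variable, as a type over the whole context. -/
def Ctx.get : {n : ℕ} → Ctx n → Fin n → Ty n
  | _, .nil => Fin.elim0
  | _, .snoc Γ A => snocFun (fun i => (Γ.get i).subst wk) (A.subst wk)

end MCaTT

namespace CaTT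

/-- The desuspension of a raw term. -/
def Tm.desusp {n : ℕ} : Tm n → MCaTT.Tm n
  | .var i => .var i
  | .constr c Γ A γ => .constr c Γ A (fun i => (γ i).desusp)

/-- The desuspension of a raw type. -/
def Ty.desusp {n : ℕ} : Ty n → MCaTT.Ty n
  | .obj => .unit
  | .hom A t u => .hom A.desusp t.desusp u.desusp

/-- The desuspension of a raw context. -/
def Ctx.desusp : {n : ℕ} → Ctx n → MCaTT.Ctx n
  | _, .nil => .nil
  | _, .snoc Γ A => .snoc Γ.desusp A.desusp

end CaTT

namespace MCaTT

/-- The judgments of MCaTT, including definitional equality of types, terms and substitutions. -/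
inductive Judgment : Type
  | ctx {n : ℕ} (Γ : Ctx n)
  | ty {n : ℕ} (Γ : Ctx n) (A : Ty n)
  | tm {n : ℕ} (Γ : Ctx n) (t : Tm n) (A : Ty n)
  | sub {m n : ℕ} (Δ : Ctx m) (γ : Fin n → Tm m) (Γ : Ctx n)
  | eqTy {n : ℕ} (Γ : Ctx n) (A B : Ty n)
  | eqTm {n : ℕ} (Γ : Ctx n) (t u : Tm n) (A : Ty n)
  | eqSub {m n : ℕ} (Δ : Ctx m) (γ δ : Fin n → Tm m) (Γ : Ctx n)

open Judgment in
/-- The derivable judgments of MCaTT. Definitional equality is the congruence that is generated by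
the rule `eta`. -/
inductive Derivable : Judgment → Prop
  | ec : Derivable (ctx .nil)
  | ce {n : ℕ} {Γ : Ctx n} {A : Ty n} :
      Derivable (ty Γ A) → Derivable (ctx (Γ.snoc A))
  | unit_intro {n : ℕ} {Γ : Ctx n} :
      Derivable (ctx Γ) → Derivable (ty Γ .unit)
  | hom_intro {n : ℕ} {Γ : Ctx n} {A : Ty n} {t u : Tm n} :
      Derivable (ty Γ A) → Derivable (tm Γ t A) → Derivable (tm Γ u A) →
      Derivable (ty Γ (.hom A t u))
  | var {n : ℕ} {Γ : Ctx n} (i : Fin n) :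
      Derivable (ctx Γ) → Derivable (tm Γ (.var i) (Γ.get i))
  | star_intro {n : ℕ} {Γ : Ctx n} :
      Derivable (ctx Γ) → Derivable (tm Γ .star .unit)
  | constr_intro {m n : ℕ} {Δ : Ctx m} {Γ : CaTT.Ctx n} {c : CaTT.Kind} {A : CaTT.Ty n}
      {γ : Fin n → Tm m} :
      CaTT.Derivable (.valid c Γ A) → Derivable (sub Δ γ Γ.desusp) →
      Derivable (tm Δ (.constr c Γ A γ) (A.desusp.subst γ))
  | es {m : ℕ} {Δ : Ctx m} {γ : Fin 0 → Tm m} :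
      Derivable (ctx Δ) → Derivable (sub Δ γ .nil)
  | se {m n : ℕ} {Δ : Ctx m} {Γ : Ctx n} {γ : Fin n → Tm m} {A : Ty n} {t : Tm m} :
      Derivable (sub Δ γ Γ) → Derivable (ty Γ A) → Derivable (tm Δ t (A.subst γ)) →
      Derivable (sub Δ (snocFun γ t) (Γ.snoc A))
  | conv {n : ℕ} {Γ : Ctx n} {t : Tm n} {A B : Ty n} :
      Derivable (tm Γ t A) → Derivable (eqTy Γ A B) → Derivable (tm Γ t B)
  | eta {n : ℕ} {Γ : Ctx n} {t u : Tm n} :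
      Derivable (tm Γ t .unit) → Derivable (tm Γ u .unit) → Derivable (eqTm Γ t u .unit)
  | eqTy_refl {n : ℕ} {Γ : Ctx n} {A : Ty n} :
      Derivable (ty Γ A) → Derivable (eqTy Γ A A)
  | eqTy_symm {n : ℕ} {Γ : Ctx n} {A B : Ty n} :
      Derivable (eqTy Γ A B) → Derivable (eqTy Γ B A)
  | eqTy_trans {n : ℕ} {Γ : Ctx n} {A B C : Ty n} :
      Derivable (eqTy Γ A B) → Derivable (eqTy Γ B C) → Derivable (eqTy Γ A C)
  | eqTy_hom {n : ℕ} {Γ : Ctx n} {A B : Ty n} {t t' u u' : Tm n} :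
      Derivable (eqTy Γ A B) → Derivable (eqTm Γ t t' A) → Derivable (eqTm Γ u u' A) →
      Derivable (eqTy Γ (.hom A t u) (.hom B t' u'))
  | eqTm_refl {n : ℕ} {Γ : Ctx n} {t : Tm n} {A : Ty n} :
      Derivable (tm Γ t A) → Derivable (eqTm Γ t t A)
  | eqTm_symm {n : ℕ} {Γ : Ctx n} {t u : Tm n} {A : Ty n} :
      Derivable (eqTm Γ t u A) → Derivable (eqTm Γ u t A)
  | eqTm_trans {n : ℕ} {Γ : Ctx n} {t u v : Tm n} {A : Ty n} :
      Derivable (eqTm Γ t u A) → Derivable (eqTm Γ u v A) → Derivable (eqTm Γ t v A)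
  | eqTm_conv {n : ℕ} {Γ : Ctx n} {t u : Tm n} {A B : Ty n} :
      Derivable (eqTm Γ t u A) → Derivable (eqTy Γ A B) → Derivable (eqTm Γ t u B)
  | eqTm_constr {m n : ℕ} {Δ : Ctx m} {Γ : CaTT.Ctx n} {c : CaTT.Kind} {A : CaTT.Ty n}
      {γ δ : Fin n → Tm m} :
      CaTT.Derivable (.valid c Γ A) → Derivable (eqSub Δ γ δ Γ.desusp) →
      Derivable (eqTm Δ (.constr c Γ A γ) (.constr c Γ A δ) (A.desusp.subst γ))
  | eqSub_nil {m : ℕ} {Δ : Ctx m} {γ δ : Fin 0 → Tm m} :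
      Derivable (ctx Δ) → Derivable (eqSub Δ γ δ .nil)
  | eqSub_snoc {m n : ℕ} {Δ : Ctx m} {Γ : Ctx n} {γ δ : Fin n → Tm m} {A : Ty n} {t u : Tm m} :
      Derivable (eqSub Δ γ δ Γ) → Derivable (ty Γ A) → Derivable (eqTm Δ t u (A.subst γ)) →
      Derivable (eqSub Δ (snocFun γ t) (snocFun δ u) (Γ.snoc A))

/-! ### Properties of substitution -/

theorem Tm.subst_subst {l m n : ℕ} (σ : Fin n → Tm m) (τ : Fin m → Tm l) :
    ∀ t : Tm n, (t.subst σ).subst τ = t.subst (fun i => (σ i).subst τ)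
  | .star => rfl
  | .var _ => rfl
  | .constr c Γ A γ => by
      simp only [Tm.subst]
      congr 1
      funext i
      exact Tm.subst_subst σ τ (γ i)

theorem Ty.subst_subst {l m n : ℕ} (σ : Fin n → Tm m) (τ : Fin m → Tm l) :
    ∀ A : Ty n, (A.subst σ).subst τ = A.subst (fun i => (σ i).subst τ)
  | .unit => rfl
  | .hom A t u => by
      simp only [Ty.subst, Tm.subst_subst, Ty.subst_subst σ τ A]

theorem Tm.subst_id {n : ℕ} : ∀ t : Tm n, t.subst .var = t
  | .star => rfl
  | .var _ => rfl
  | .constr c Γ A γ => by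
      simp only [Tm.subst]
      congr 1
      funext i
      exact Tm.subst_id (γ i)

theorem Ty.subst_id {n : ℕ} : ∀ A : Ty n, A.subst .var = A
  | .unit => rfl
  | .hom A t u => by simp only [Ty.subst, Tm.subst_id, Ty.subst_id A]

theorem Tm.subst_wk_snoc {m n : ℕ} (γ : Fin n → Tm m) (t : Tm m) (u : Tm n) :
    (u.subst wk).subst (snocFun γ t) = u.subst γ := by
  rw [Tm.subst_subst]
  congr 1
  funext i
  simp [wk, Tm.subst]

theorem Ty.subst_wk_snoc {m n : ℕ} (γ : Fin n → Tm m) (t : Tm m) (A : Ty n) :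
    (A.subst wk).subst (snocFun γ t) = A.subst γ := by
  rw [Ty.subst_subst]
  congr 1
  funext i
  simp [wk, Tm.subst]

theorem Ctx.get_last {n : ℕ} (Γ : Ctx n) (A : Ty n) :
    (Γ.snoc A).get (Fin.last n) = A.subst wk := by simp [Ctx.get]

theorem Ctx.get_castSucc {n : ℕ} (Γ : Ctx n) (A : Ty n) (i : Fin n) :
    (Γ.snoc A).get i.castSucc = (Γ.get i).subst wk := by simp [Ctx.get]

open Judgment

/-- What a derivable judgment presupposes. -/
def Presup : Judgment → Prop
  | ctx _ => True
  | ty Γ _ => Derivable (ctx Γ)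
  | tm Γ _ _ => Derivable (ctx Γ)
  | sub Δ γ Γ => Derivable (ctx Δ) ∧ Derivable (ctx Γ) ∧
      ∀ i, Derivable (tm Δ (γ i) ((Γ.get i).subst γ))
  | eqTy Γ _ _ => Derivable (ctx Γ)
  | eqTm Γ _ _ _ => Derivable (ctx Γ)
  | eqSub Δ _ _ _ => Derivable (ctx Δ)

theorem Derivable.presup {J : Judgment} (h : Derivable J) : Presup J := by
  induction h with
  | ec => trivial
  | ce => trivial
  | unit_intro h => exact h
  | hom_intro _ _ _ ih => exact ih
  | var i h => exact h
  | star_intro h => exact h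
  | constr_intro _ _ ih => exact ih.1
  | es h => exact ⟨h, .ec, fun i => i.elim0⟩
  | se _ hA ht ih _ _ =>
      refine ⟨ih.1, .ce hA, fun i => ?_⟩
      refine Fin.lastCases ?_ (fun j => ?_) i
      · simpa [Ctx.get_last, Ty.subst_wk_snoc] using ht
      · simpa [Ctx.get_castSucc, Ty.subst_wk_snoc] using ih.2.2 j
  | conv _ _ ih => exact ih
  | eta _ _ ih => exact ih
  | eqTy_refl _ ih => exact ih
  | eqTy_symm _ ih => exact ih
  | eqTy_trans _ _ ih => exact ih
  | eqTy_hom _ _ _ ih => exact ih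
  | eqTm_refl _ ih => exact ih
  | eqTm_symm _ ih => exact ih
  | eqTm_trans _ _ ih => exact ih
  | eqTm_conv _ _ ih => exact ih
  | eqTm_constr _ _ ih => exact ih
  | eqSub_nil h => exact h
  | eqSub_snoc _ _ _ ih => exact ih

theorem Derivable.ty_of_ctx_snoc {n : ℕ} {Γ : Ctx n} {A : Ty n}
    (h : Derivable (ctx (Γ.snoc A))) : Derivable (ty Γ A) := by
  cases h with
  | ce h => exact h

theorem Derivable.sub_of_forall {m : ℕ} {Δ : Ctx m} (hΔ : Derivable (ctx Δ)) :
    ∀ {n : ℕ} {Γ : Ctx n} {γ : Fin n → Tm m}, Derivable (ctx Γ) →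
      (∀ i, Derivable (tm Δ (γ i) ((Γ.get i).subst γ))) → Derivable (sub Δ γ Γ)
  | _, .nil, _, _, _ => .es hΔ
  | _, .snoc Γ A, γ, hΓ, h => by
      have hA := hΓ.ty_of_ctx_snoc
      rw [CaTT.eq_snocFun γ] at h ⊢
      refine .se (Derivable.sub_of_forall hΔ hA.presup fun i => ?_) hA ?_
      · simpa [Ctx.get_castSucc, Ty.subst_wk_snoc] using h i.castSucc
      · simpa [Ctx.get_last, Ty.subst_wk_snoc] using h (Fin.last _)

theorem Derivable.wk {n : ℕ} {Γ : Ctx n} {A : Ty n} (h : Derivable (ty Γ A)) :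
    Derivable (sub (Γ.snoc A) wk Γ) :=
  .sub_of_forall (.ce h) h.presup fun i => by
    rw [← Ctx.get_castSucc Γ A]
    exact Derivable.var i.castSucc (.ce h)

/-- Admissibility of substitution. -/
def Stable : Judgment → Prop
  | ctx _ => True
  | ty Γ A => ∀ {m : ℕ} {Δ : Ctx m} {σ}, Derivable (sub Δ σ Γ) → Derivable (ty Δ (A.subst σ))
  | tm Γ t A => ∀ {m : ℕ} {Δ : Ctx m} {σ}, Derivable (sub Δ σ Γ) →
      Derivable (tm Δ (t.subst σ) (A.subst σ))
  | sub Γ γ Θ => ∀ {m : ℕ} {Δ : Ctx m} {σ}, Derivable (sub Δ σ Γ) →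
      Derivable (sub Δ (fun i => (γ i).subst σ) Θ)
  | eqTy Γ A B => ∀ {m : ℕ} {Δ : Ctx m} {σ}, Derivable (sub Δ σ Γ) →
      Derivable (eqTy Δ (A.subst σ) (B.subst σ))
  | eqTm Γ t u A => ∀ {m : ℕ} {Δ : Ctx m} {σ}, Derivable (sub Δ σ Γ) →
      Derivable (eqTm Δ (t.subst σ) (u.subst σ) (A.subst σ))
  | eqSub Γ γ δ Θ => ∀ {m : ℕ} {Δ : Ctx m} {σ}, Derivable (sub Δ σ Γ) →
      Derivable (eqSub Δ (fun i => (γ i).subst σ) (fun i => (δ i).subst σ) Θ)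

theorem Derivable.stable {J : Judgment} (h : Derivable J) : Stable J := by
  induction h with
  | ec => trivial
  | ce => trivial
  | unit_intro h => exact fun hσ => .unit_intro hσ.presup.1
  | hom_intro _ _ _ ih₁ ih₂ ih₃ => exact fun hσ => .hom_intro (ih₁ hσ) (ih₂ hσ) (ih₃ hσ)
  | var i h => exact fun hσ => hσ.presup.2.2 i
  | star_intro h => exact fun hσ => .star_intro hσ.presup.1
  | constr_intro hv _ ih =>
      intro _ _ _ hσ
      rw [Ty.subst_subst]
      exact .constr_intro hv (ih hσ)
  | es h => exact fun hσ => .es hσ.presup.1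
  | se _ hA _ ih₁ _ ih₂ =>
      intro _ _ σ hσ
      rw [comp_snocFun]
      refine .se (ih₁ hσ) hA ?_
      simpa only [Ty.subst_subst] using ih₂ hσ
  | conv _ _ ih₁ ih₂ => exact fun hσ => .conv (ih₁ hσ) (ih₂ hσ)
  | eta _ _ ih₁ ih₂ => exact fun hσ => .eta (ih₁ hσ) (ih₂ hσ)
  | eqTy_refl _ ih => exact fun hσ => .eqTy_refl (ih hσ)
  | eqTy_symm _ ih => exact fun hσ => .eqTy_symm (ih hσ)
  | eqTy_trans _ _ ih₁ ih₂ => exact fun hσ => .eqTy_trans (ih₁ hσ) (ih₂ hσ)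
  | eqTy_hom _ _ _ ih₁ ih₂ ih₃ => exact fun hσ => .eqTy_hom (ih₁ hσ) (ih₂ hσ) (ih₃ hσ)
  | eqTm_refl _ ih => exact fun hσ => .eqTm_refl (ih hσ)
  | eqTm_symm _ ih => exact fun hσ => .eqTm_symm (ih hσ)
  | eqTm_trans _ _ ih₁ ih₂ => exact fun hσ => .eqTm_trans (ih₁ hσ) (ih₂ hσ)
  | eqTm_conv _ _ ih₁ ih₂ => exact fun hσ => .eqTm_conv (ih₁ hσ) (ih₂ hσ)
  | eqTm_constr hv _ ih =>
      intro _ _ _ hσ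
      rw [Ty.subst_subst]
      exact .eqTm_constr hv (ih hσ)
  | eqSub_nil h => exact fun hσ => .eqSub_nil hσ.presup.1
  | eqSub_snoc _ hA _ ih₁ _ ih₂ =>
      intro _ _ σ hσ
      rw [comp_snocFun, comp_snocFun]
      refine .eqSub_snoc (ih₁ hσ) hA ?_
      simpa only [Ty.subst_subst] using ih₂ hσ

/-! ### Normal forms -/

/-- The substitution of `()` for the variables of type unit of a context. -/
def Ctx.nu : {n : ℕ} → Ctx n → Fin n → Tm n
  | _, .nil => Fin.elim0
  | _, .snoc (n := n) Γ .unit => snocFun (fun i => (Γ.nu i).subst wk) .star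
  | _, .snoc (n := n) Γ (.hom _ _ _) => snocFun (fun i => (Γ.nu i).subst wk) (.var (Fin.last n))

/-- The normal form of a context: in its types, every variable of type unit is replaced by `()`.
The normal form of a term `t` or a type `A` in the context `Γ` is `t.subst Γ.nu` or
`A.subst Γ.nu`. -/
def Ctx.nf : {n : ℕ} → Ctx n → Ctx n
  | _, .nil => .nil
  | _, .snoc Γ A => .snoc Γ.nf (A.subst Γ.nu)

theorem Ctx.nu_castSucc {n : ℕ} (Γ : Ctx n) (A : Ty n) (i : Fin n) :
    (Γ.snoc A).nu i.castSucc = (Γ.nu i).subst wk := by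
  cases A <;> simp [Ctx.nu]

theorem Ctx.nu_cases {n : ℕ} : ∀ (Γ : Ctx n) (i : Fin n),
    (Γ.get i = .unit ∧ Γ.nu i = .star) ∨ (Γ.get i ≠ .unit ∧ Γ.nu i = .var i)
  | .nil, i => i.elim0
  | .snoc Γ A, i => by
      refine Fin.lastCases ?_ (fun j => ?_) i
      · cases A <;> simp [Ctx.nu, Ctx.get, Ty.subst]
      · rw [Ctx.nu_castSucc, Ctx.get_castSucc]
        rcases Ctx.nu_cases Γ j with ⟨h, h'⟩ | ⟨h, h'⟩
        · left
          simp [h, h', Ty.subst, Tm.subst]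
        · right
          refine ⟨fun h'' => h ?_, by simp [h', Tm.subst, wk]⟩
          revert h''
          cases Γ.get j <;> simp [Ty.subst]

theorem Ctx.nu_nu {n : ℕ} (Γ : Ctx n) (i : Fin n) : (Γ.nu i).subst Γ.nu = Γ.nu i := by
  rcases Γ.nu_cases i with ⟨_, h⟩ | ⟨_, h⟩ <;> simp [h, Tm.subst]

theorem Ctx.nu_nf : ∀ {n : ℕ} (Γ : Ctx n), Γ.nf.nu = Γ.nu
  | _, .nil => rfl
  | _, .snoc Γ A => by cases A <;> simp [Ctx.nf, Ctx.nu, Ty.subst, Ctx.nu_nf Γ]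

theorem Ctx.nf_nf : ∀ {n : ℕ} (Γ : Ctx n), Γ.nf.nf = Γ.nf
  | _, .nil => rfl
  | _, .snoc Γ A => by
      simp only [Ctx.nf, Ctx.nf_nf Γ, Ctx.nu_nf, Ty.subst_subst, Ctx.nu_nu]

theorem Ctx.subst_wk_nu {n : ℕ} (Γ : Ctx n) (A B : Ty n) :
    (B.subst wk).subst (Γ.snoc A).nu = (B.subst Γ.nu).subst wk := by
  rw [Ty.subst_subst, Ty.subst_subst]
  congr 1
  funext i
  exact Ctx.nu_castSucc Γ A i

theorem Ctx.proj_normal {n : ℕ} (Γ : Ctx n) (A : Ty n) (i : Fin n) :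
    ((Γ.nu i).subst wk).subst (Γ.snoc A).nu = (Γ.nu i).subst wk := by
  have h : ∀ j, (wk j).subst (Γ.snoc A).nu = (Γ.nu j).subst wk := Ctx.nu_castSucc Γ A
  simp only [Tm.subst_subst, h]
  rw [← Tm.subst_subst, Ctx.nu_nu]

theorem Ctx.get_nf : ∀ {n : ℕ} (Γ : Ctx n) (i : Fin n), Γ.nf.get i = (Γ.get i).subst Γ.nu
  | _, .nil, i => i.elim0
  | _, .snoc Γ A, i => by
      refine Fin.lastCases ?_ (fun j => ?_) i
      · simp [Ctx.nf, Ctx.get_last, Ctx.subst_wk_nu]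
      · simp [Ctx.nf, Ctx.get_castSucc, Ctx.subst_wk_nu, Ctx.get_nf Γ j]

theorem Derivable.get : ∀ {n : ℕ} {Γ : Ctx n}, Derivable (ctx Γ) →
    ∀ i, Derivable (ty Γ (Γ.get i))
  | _, .nil, _, i => i.elim0
  | _, .snoc Γ A, h, i => by
      have hA := h.ty_of_ctx_snoc
      refine Fin.lastCases ?_ (fun j => ?_) i
      · rw [Ctx.get_last]
        exact hA.stable hA.wk
      · rw [Ctx.get_castSucc]
        exact (Derivable.get hA.presup j).stable hA.wk

theorem Derivable.nu : ∀ {n : ℕ} {Γ : Ctx n}, Derivable (ctx Γ) → Derivable (sub Γ.nf Γ.nu Γ)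
  | _, .nil, _ => .es .ec
  | _, .snoc Γ A, h => by
      have hA := h.ty_of_ctx_snoc
      have ih := Derivable.nu hA.presup
      have hA' : Derivable (ty Γ.nf (A.subst Γ.nu)) := hA.stable ih
      have hc : Derivable (ctx (Γ.snoc A).nf) := .ce hA'
      refine .sub_of_forall hc h fun i => ?_
      rw [← Ctx.get_nf]
      have hv := Derivable.var i hc
      rcases (Γ.snoc A).nu_cases i with ⟨h₁, h₂⟩ | ⟨h₁, h₂⟩
      · rw [Ctx.get_nf, h₁, h₂]
        exact .star_intro hc
      · rw [h₂]
        exact hv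

/-- A term of type unit is `()` or a variable of type unit. -/
def UnitInv : Judgment → Prop
  | tm Γ t A => A = .unit → t = .star ∨ ∃ i, t = .var i ∧ Γ.get i = .unit
  | eqTy _ A B => A = .unit ↔ B = .unit
  | _ => True

theorem CaTT_valid_desusp {c : CaTT.Kind} {n : ℕ} {Γ : CaTT.Ctx n} {A : CaTT.Ty n}
    (h : CaTT.Derivable (.valid c Γ A)) : A.desusp ≠ .unit := by
  cases h <;> simp [CaTT.Ty.desusp]

theorem Ty.subst_eq_unit {m n : ℕ} {σ : Fin n → Tm m} {A : Ty n} :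
    A.subst σ = .unit ↔ A = .unit := by
  cases A <;> simp [Ty.subst]

theorem Derivable.unitInv {J : Judgment} (h : Derivable J) : UnitInv J := by
  induction h with
  | var i h => exact fun h => .inr ⟨i, rfl, h⟩
  | star_intro h => exact fun _ => .inl rfl
  | constr_intro hv _ _ =>
      exact fun h => (CaTT_valid_desusp hv (Ty.subst_eq_unit.1 h)).elim
  | conv _ _ ih₁ ih₂ => exact fun h => ih₁ (ih₂.2 h)
  | eqTy_refl _ _ => exact Iff.rfl
  | eqTy_symm _ ih => exact ih.symm
  | eqTy_trans _ _ ih₁ ih₂ => exact ih₁.trans ih₂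
  | eqTy_hom => simp [UnitInv]
  | _ => trivial

theorem Derivable.nf_of_unit {n : ℕ} {Γ : Ctx n} {t : Tm n} (h : Derivable (tm Γ t .unit)) :
    t.subst Γ.nu = .star := by
  rcases h.unitInv rfl with rfl | ⟨i, rfl, hi⟩
  · rfl
  · rcases Γ.nu_cases i with ⟨_, h⟩ | ⟨h, _⟩
    · exact h
    · exact (h hi).elim

/-- Every derivable substitution in normal form absorbs the normalisation of its codomain. -/
theorem Derivable.nu_subst {m n : ℕ} {Δ : Ctx m} {Γ : Ctx n} {σ : Fin n → Tm m}
    (h : Derivable (sub Δ σ Γ)) (hσ : ∀ i, (σ i).subst Δ.nu = σ i) (i : Fin n) :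
    (Γ.nu i).subst σ = σ i := by
  rcases Γ.nu_cases i with ⟨h₁, h₂⟩ | ⟨h₁, h₂⟩
  · have h' := h.presup.2.2 i
    rw [h₁] at h'
    rw [h₂, ← hσ i, Derivable.nf_of_unit h', Tm.subst]
  · rw [h₂, Tm.subst]

theorem Derivable.sub_nf {m n : ℕ} {Δ : Ctx m} {Γ : Ctx n} {σ : Fin n → Tm m}
    (h : Derivable (sub Δ σ Γ)) (hσ : ∀ i, (σ i).subst Δ.nu = σ i) :
    Derivable (sub Δ σ Γ.nf) := by
  refine .sub_of_forall h.presup.1 h.presup.2.1.nu.presup.1 fun i => ?_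
  rw [Ctx.get_nf, Ty.subst_subst]
  simp only [h.nu_subst hσ]
  exact h.presup.2.2 i

/-! ### The syntactic category -/

/-- Objects of the syntactic category of MCaTT: the derivable contexts up to definitional equality,
that is the derivable contexts in normal form. -/
structure Syn : Type where
  {len : ℕ}
  ctx : Ctx len
  ok : Derivable (.ctx ctx)
  normal : ctx.nf = ctx

/-- Morphisms of the syntactic category of MCaTT: the derivable substitutions up to definitional
equality, that is the derivable substitutions in normal form. -/
@[ext] structure Syn.Hom (Δ Γ : Syn) : Type where
  toFun : Fin Γ.len → Tm Δ.len
  ok : Derivable (.sub Δ.ctx toFun Γ.ctx)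
  normal : ∀ i, (toFun i).subst Δ.ctx.nu = toFun i

theorem Syn.nu_ok (Γ : Syn) : Derivable (.sub Γ.ctx Γ.ctx.nu Γ.ctx) := by
  have h := Γ.ok.nu
  rwa [Γ.normal] at h

instance : Category Syn where
  Hom := Syn.Hom
  id Γ := ⟨Γ.ctx.nu, Γ.nu_ok, Γ.ctx.nu_nu⟩
  comp f g := ⟨fun i => (g.toFun i).subst f.toFun, g.ok.stable f.ok, fun i => by
    simp only [Tm.subst_subst, f.normal]⟩
  id_comp f := Syn.Hom.ext (funext f.normal)
  comp_id f := Syn.Hom.ext (funext (f.ok.nu_subst f.normal))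
  assoc f g h := Syn.Hom.ext (funext fun i => (Tm.subst_subst g.toFun f.toFun (h.toFun i)).symm)

/-- The extended context `(Γ, x : A)`. -/
abbrev Syn.ext (Γ : Syn) (A : Ty Γ.len) (hA : Derivable (.ty Γ.ctx A))
    (hn : A.subst Γ.ctx.nu = A) : Syn :=
  ⟨Γ.ctx.snoc A, .ce hA, by rw [Ctx.nf, Γ.normal, hn]⟩

/-- The projection `(Γ, x : A) ⟶ Γ`. -/
def Syn.proj (Γ : Syn) (A : Ty Γ.len) (hA : Derivable (.ty Γ.ctx A))
    (hn : A.subst Γ.ctx.nu = A) : Γ.ext A hA hn ⟶ Γ :=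
  ⟨fun i => (Γ.ctx.nu i).subst MCaTT.wk, Γ.nu_ok.stable hA.wk, Γ.ctx.proj_normal A⟩

/-- The display maps of the syntactic category of MCaTT. -/
inductive displayMaps : MorphismProperty Syn
  | mk (Γ : Syn) (A : Ty Γ.len) (hA : Derivable (.ty Γ.ctx A)) (hn : A.subst Γ.ctx.nu = A) :
      displayMaps (Γ.proj A hA hn)

end MCaTT

/-! ## Desuspension -/

namespace CaTT

theorem Tm.desusp_subst {m n : ℕ} (σ : Fin n → Tm m) :
    ∀ t : Tm n, (t.subst σ).desusp = t.desusp.subst (fun i => (σ i).desusp)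
  | .var _ => rfl
  | .constr c Γ A γ => by
      simp only [Tm.subst, Tm.desusp, MCaTT.Tm.subst]
      congr 1
      funext i
      exact Tm.desusp_subst σ (γ i)

theorem Ty.desusp_subst {m n : ℕ} (σ : Fin n → Tm m) :
    ∀ A : Ty n, (A.subst σ).desusp = A.desusp.subst (fun i => (σ i).desusp)
  | .obj => rfl
  | .hom A t u => by
      simp only [Ty.subst, Ty.desusp, MCaTT.Ty.subst, Tm.desusp_subst, Ty.desusp_subst σ A]

theorem Ctx.get_desusp : ∀ {n : ℕ} (Γ : Ctx n) (i : Fin n),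
    Γ.desusp.get i = (Γ.get i).desusp
  | _, .nil, i => i.elim0
  | _, .snoc Γ A, i => by
      have hwk : ∀ {n : ℕ}, (fun i : Fin n => (wk i).desusp) = MCaTT.wk := rfl
      refine Fin.lastCases ?_ (fun j => ?_) i
      · rw [Ctx.desusp, MCaTT.Ctx.get_last, Ctx.get_last, Ty.desusp_subst, hwk]
      · rw [Ctx.desusp, MCaTT.Ctx.get_castSucc, Ctx.get_castSucc, Ty.desusp_subst, hwk,
          Ctx.get_desusp Γ j]

/-- Desuspension sends derivable judgments of CaTT to derivable judgments of MCaTT. -/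
def DesuspOk : Judgment → Prop
  | .ctx Γ => MCaTT.Derivable (.ctx Γ.desusp)
  | .ty Γ A => MCaTT.Derivable (.ty Γ.desusp A.desusp)
  | .tm Γ t A => MCaTT.Derivable (.tm Γ.desusp t.desusp A.desusp) ∧
      MCaTT.Derivable (.ty Γ.desusp A.desusp)
  | .sub Δ γ Γ => MCaTT.Derivable (.sub Δ.desusp (fun i => (γ i).desusp) Γ.desusp)
  | .valid _ Γ A => MCaTT.Derivable (.ty Γ.desusp A.desusp)

theorem Derivable.desusp {J : Judgment} (h : Derivable J) : DesuspOk J := by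
  induction h with
  | ec => exact .ec
  | ce _ ih => exact .ce ih
  | obj_intro _ ih => exact .unit_intro ih
  | hom_intro _ _ ih₁ ih₂ => exact .hom_intro ih₁.2 ih₁.1 ih₂.1
  | @var n Γ i _ ih =>
      have h : MCaTT.Derivable (.ctx Γ.desusp) := ih
      refine ⟨?_, ?_⟩ <;> rw [← Ctx.get_desusp]
      · exact .var i h
      · exact h.get i
  | valid_op _ _ _ _ _ _ ih₁ ih₂ => exact .hom_intro ih₁.2 ih₁.1 ih₂.1
  | valid_coh _ _ _ _ _ ih₁ ih₂ => exact .hom_intro ih₁.2 ih₁.1 ih₂.1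
  | constr_intro hv _ ih₁ ih₂ =>
      refine ⟨?_, ?_⟩ <;> rw [Ty.desusp_subst]
      · exact .constr_intro hv ih₂
      · exact MCaTT.Derivable.stable ih₁ ih₂
  | es _ ih => exact .es ih
  | se _ _ _ ih₁ ih₂ ih₃ =>
      simp only [DesuspOk]
      rw [comp_snocFun]
      refine .se ih₁ ih₂ ?_
      rw [← Ty.desusp_subst]
      exact ih₃.1

/-- The desuspension of an object: the normal form of the desuspended context. -/
def Syn.desuspObj (Γ : Syn) : MCaTT.Syn :=
  ⟨Γ.ctx.desusp.nf, (MCaTT.Derivable.nu Γ.ok.desusp).presup.1, Γ.ctx.desusp.nf_nf⟩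

/-- The desuspension of a morphism: the normal form of the desuspended substitution. -/
def Syn.desuspMap {Δ Γ : Syn} (f : Δ ⟶ Γ) : Δ.desuspObj ⟶ Γ.desuspObj :=
  have hn : ∀ i, (((f.toFun i).desusp.subst Δ.ctx.desusp.nu).subst Δ.ctx.desusp.nf.nu) =
      (f.toFun i).desusp.subst Δ.ctx.desusp.nu := fun i => by
    simp only [MCaTT.Ctx.nu_nf, MCaTT.Tm.subst_subst, MCaTT.Ctx.nu_nu]
  ⟨fun i => (f.toFun i).desusp.subst Δ.ctx.desusp.nu,
    MCaTT.Derivable.sub_nf (MCaTT.Derivable.stable f.ok.desusp (MCaTT.Derivable.nu Δ.ok.desusp)) hn,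
    hn⟩

end CaTT

/-- The desuspension functor from the syntactic category of CaTT to that of MCaTT. -/
def desuspension : CaTT.Syn ⥤ MCaTT.Syn where
  obj Γ := Γ.desuspObj
  map f := CaTT.Syn.desuspMap f
  map_id Γ := MCaTT.Syn.Hom.ext (by
    funext i
    exact congrFun (MCaTT.Ctx.nu_nf Γ.ctx.desusp).symm i)
  map_comp {X Y Z} f g := MCaTT.Syn.Hom.ext (by
    funext i
    change ((g.toFun i).subst f.toFun).desusp.subst X.ctx.desusp.nu =
      ((g.toFun i).desusp.subst Y.ctx.desusp.nu).subst
        (fun i => (f.toFun i).desusp.subst X.ctx.desusp.nu)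
    rw [CaTT.Tm.desusp_subst, MCaTT.Tm.subst_subst, MCaTT.Tm.subst_subst]
    congr 1
    funext j
    refine (MCaTT.Derivable.nu_subst (Δ := X.ctx.desusp.nf) (MCaTT.Derivable.stable f.ok.desusp
      (MCaTT.Derivable.nu X.ok.desusp)) (fun i => ?_) j).symm
    simp only [MCaTT.Ctx.nu_nf, MCaTT.Tm.subst_subst, MCaTT.Ctx.nu_nu])

/-! ## Reduced suspension

The reduced suspension of a context consists of a new variable `•` of type `⋆`, in first position,
and of one variable for each variable whose type is not unit. -/

namespace MCaTT

/-- The length of the reduced suspension of a context. -/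
@[reducible] def Ctx.rlen : {n : ℕ} → Ctx n → ℕ
  | _, .nil => 1
  | _, .snoc Γ .unit => Γ.rlen
  | _, .snoc Γ (.hom _ _ _) => Γ.rlen + 1

/-- The variable `•` of the reduced suspension of a context. -/
def Ctx.point : {n : ℕ} → (Γ : Ctx n) → Fin Γ.rlen
  | _, .nil => Fin.last 0
  | _, .snoc Γ .unit => Γ.point
  | _, .snoc Γ (.hom _ _ _) => Γ.point.castSucc

/-- The reduced suspension of the variables of a context: a variable of type unit is sent to `•`,
and any other one to the corresponding variable. -/
def Ctx.rvar : {n : ℕ} → (Γ : Ctx n) → Fin n → Fin Γ.rlen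
  | _, .nil => Fin.elim0
  | _, .snoc Γ .unit => snocFun Γ.rvar Γ.point
  | _, .snoc Γ (.hom _ _ _) => snocFun (fun i => (Γ.rvar i).castSucc) (Fin.last Γ.rlen)

/-- The list of terms that a reduced suspended substitution with codomain `Γ` consists of: the
term `b` for the variable `•`, and the entries of `γ` for the variables of `Γ` whose type is not
unit. -/
def Ctx.rsub {m : ℕ} (b : CaTT.Tm m) :
    {n : ℕ} → (Γ : Ctx n) → (Fin n → CaTT.Tm m) → Fin Γ.rlen → CaTT.Tm m
  | _, .nil, _ => fun _ => b
  | _, .snoc Γ .unit, γ => Γ.rsub b (fun i => γ i.castSucc)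
  | _, .snoc (n := n) Γ (.hom _ _ _), γ =>
      snocFun (Γ.rsub b (fun i => γ i.castSucc)) (γ (Fin.last n))

end MCaTT

/-- The substitution from the reduced suspension of the desuspension of `Γ` to `Γ`: it maps a
variable to the reduced suspension of its desuspension. -/
def CaTT.Ctx.red {n : ℕ} (Γ : CaTT.Ctx n) : Fin n → CaTT.Tm Γ.desusp.rlen :=
  fun i => .var (Γ.desusp.rvar i)

namespace MCaTT

/-- The reduced suspension of a term of the context `Δ`. -/
def Tm.rsusp {n : ℕ} (Δ : Ctx n) : Tm n → CaTT.Tm Δ.rlen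
  | .star => .var Δ.point
  | .var i => .var (Δ.rvar i)
  | .constr c Γ A γ => .constr c Γ A (fun i =>
      (Γ.red i).subst (Γ.desusp.rsub (.var Δ.point) (fun j => (γ j).rsusp Δ)))

/-- The reduced suspension of a type of the context `Δ`. -/
def Ty.rsusp {n : ℕ} (Δ : Ctx n) : Ty n → CaTT.Ty Δ.rlen
  | .unit => .obj
  | .hom A t u => .hom (A.rsusp Δ) (t.rsusp Δ) (u.rsusp Δ)

/-- The reduced suspension of a context. -/
def Ctx.rsusp : {n : ℕ} → (Γ : Ctx n) → CaTT.Ctx Γ.rlen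
  | _, .nil => .snoc .nil .obj
  | _, .snoc Γ .unit => Γ.rsusp
  | _, .snoc Γ (.hom A t u) => .snoc Γ.rsusp (Ty.rsusp Γ (.hom A t u))

/-- The reduced suspension of a substitution from `Δ` to `Γ`. -/
def rsuspSub {m n : ℕ} (Δ : Ctx m) (γ : Fin n → Tm m) (Γ : Ctx n) :
    Fin Γ.rlen → CaTT.Tm Δ.rlen :=
  Γ.rsub (.var Δ.point) (fun i => (γ i).rsusp Δ)

/-! ### Properties of the reduced suspension -/

theorem Ctx.rsub_point {m : ℕ} (b : CaTT.Tm m) :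
    ∀ {n : ℕ} (Γ : Ctx n) (γ : Fin n → CaTT.Tm m), Γ.rsub b γ Γ.point = b
  | _, .nil, _ => rfl
  | _, .snoc Γ .unit, γ => Γ.rsub_point b _
  | _, .snoc Γ (.hom _ _ _), γ => by
      simp only [Ctx.rsub, Ctx.point, snocFun_castSucc]
      exact Γ.rsub_point b _

theorem Ctx.rsub_rvar {m : ℕ} (b : CaTT.Tm m) :
    ∀ {n : ℕ} (Γ : Ctx n) (γ : Fin n → CaTT.Tm m),
      (∀ i, Γ.get i = .unit → γ i = b) → ∀ i, Γ.rsub b γ (Γ.rvar i) = γ i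
  | _, .nil, _, _, i => i.elim0
  | _, .snoc Γ A, γ, h, i => by
      have ih := Γ.rsub_rvar b (fun i => γ i.castSucc) (fun i hi => h i.castSucc (by
        rw [Ctx.get_castSucc, hi, Ty.subst]))
      cases A with
      | unit =>
          refine Fin.lastCases ?_ (fun j => ?_) i
          · simp only [Ctx.rsub, Ctx.rvar, snocFun_last, Ctx.rsub_point]
            exact (h _ (by rw [Ctx.get_last, Ty.subst])).symm
          · simp only [Ctx.rsub, Ctx.rvar, snocFun_castSucc]
            exact ih j
      | hom B t u =>
          refine Fin.lastCases ?_ (fun j => ?_) i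
          · simp only [Ctx.rsub, Ctx.rvar, snocFun_last]
          · simp only [Ctx.rsub, Ctx.rvar, snocFun_castSucc]
            exact ih j

theorem Ctx.rsub_subst {l m : ℕ} (b : CaTT.Tm m) (σ : Fin m → CaTT.Tm l) :
    ∀ {n : ℕ} (Γ : Ctx n) (γ : Fin n → CaTT.Tm m) (i : Fin Γ.rlen),
      (Γ.rsub b γ i).subst σ = Γ.rsub (b.subst σ) (fun j => (γ j).subst σ) i
  | _, .nil, _, _ => rfl
  | _, .snoc Γ .unit, γ, i => Γ.rsub_subst b σ _ i
  | _, .snoc Γ (.hom _ _ _), γ, i => by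
      simp only [Ctx.rsub] at i ⊢
      refine Fin.lastCases ?_ (fun j => ?_) i
      · simp
      · simp only [snocFun_castSucc]
        exact Γ.rsub_subst b σ _ j

theorem Tm.rsusp_subst {m n : ℕ} (Δ : Ctx m) (Γ : Ctx n) (σ : Fin n → Tm m)
    (h : ∀ i, Γ.get i = .unit → (σ i).rsusp Δ = .var Δ.point) :
    ∀ t : Tm n, (t.subst σ).rsusp Δ = (t.rsusp Γ).subst (rsuspSub Δ σ Γ)
  | .star => (Ctx.rsub_point _ Γ _).symm
  | .var i => (Ctx.rsub_rvar _ Γ _ h i).symm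
  | .constr c Θ A γ => by
      simp only [Tm.subst, Tm.rsusp, CaTT.Tm.subst]
      congr 1
      funext i
      simp only [CaTT.Ctx.red, CaTT.Tm.subst]
      rw [Ctx.rsub_subst]
      congr 1
      · exact (Ctx.rsub_point _ Γ _).symm
      · funext j
        exact Tm.rsusp_subst Δ Γ σ h (γ j)

theorem Ty.rsusp_subst {m n : ℕ} (Δ : Ctx m) (Γ : Ctx n) (σ : Fin n → Tm m)
    (h : ∀ i, Γ.get i = .unit → (σ i).rsusp Δ = .var Δ.point) :
    ∀ A : Ty n, (A.subst σ).rsusp Δ = (A.rsusp Γ).subst (rsuspSub Δ σ Γ)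
  | .unit => rfl
  | .hom A t u => by
      simp only [Ty.subst, Ty.rsusp, CaTT.Ty.subst, Tm.rsusp_subst Δ Γ σ h,
        Ty.rsusp_subst Δ Γ σ h A]

theorem Ctx.rvar_of_unit : ∀ {n : ℕ} (Γ : Ctx n) (i : Fin n), Γ.get i = .unit →
    Γ.rvar i = Γ.point
  | _, .nil, i, _ => i.elim0
  | _, .snoc Γ A, i, h => by
      revert h
      refine Fin.lastCases ?_ (fun j => ?_) i
      · intro h
        rw [Ctx.get_last, Ty.subst_eq_unit] at h
        subst h
        simp [Ctx.rvar, Ctx.point]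
      · intro h
        rw [Ctx.get_castSucc, Ty.subst_eq_unit] at h
        cases A with
        | unit => simpa [Ctx.rvar, Ctx.point] using Γ.rvar_of_unit j h
        | hom => simpa [Ctx.rvar, Ctx.point] using Γ.rvar_of_unit j h

open Judgment

theorem Derivable.rsusp_of_unit {n : ℕ} {Γ : Ctx n} {t : Tm n} (h : Derivable (tm Γ t .unit)) :
    t.rsusp Γ = .var Γ.point := by
  rcases h.unitInv rfl with rfl | ⟨i, rfl, hi⟩
  · rfl
  · rw [Tm.rsusp, Ctx.rvar_of_unit Γ i hi]

theorem Derivable.rsusp_sub {m n : ℕ} {Δ : Ctx m} {Γ : Ctx n} {σ : Fin n → Tm m}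
    (h : Derivable (sub Δ σ Γ)) (i : Fin n) (hi : Γ.get i = .unit) :
    (σ i).rsusp Δ = .var Δ.point :=
  Derivable.rsusp_of_unit (by
    have h' := h.presup.2.2 i
    rwa [hi] at h')

/-- The reduced suspension of a weakened type. -/
theorem Tm.rsusp_wk_unit {n : ℕ} (Γ : Ctx n) :
    ∀ t : Tm n, (t.subst wk).rsusp (Γ.snoc .unit) = t.rsusp Γ
  | .star => rfl
  | .var i => by simp [Tm.subst, wk, Tm.rsusp, Ctx.rvar]
  | .constr c Θ A γ => by
      simp only [Tm.subst, Tm.rsusp]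
      congr 1
      funext i
      congr 2
      funext j
      exact Tm.rsusp_wk_unit Γ (γ j)

theorem Ty.rsusp_wk_unit {n : ℕ} (Γ : Ctx n) :
    ∀ A : Ty n, (A.subst wk).rsusp (Γ.snoc .unit) = A.rsusp Γ
  | .unit => rfl
  | .hom A t u => by
      simp only [Ty.subst, Ty.rsusp, Tm.rsusp_wk_unit, Ty.rsusp_wk_unit Γ A]

theorem Tm.rsusp_wk_hom {n : ℕ} (Γ : Ctx n) (B : Ty n) (v w : Tm n) :
    ∀ t : Tm n, (t.subst wk).rsusp (Γ.snoc (.hom B v w)) = (t.rsusp Γ).subst CaTT.wk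
  | .star => rfl
  | .var i => by simp [Tm.subst, wk, Tm.rsusp, Ctx.rvar]; rfl
  | .constr c Θ A γ => by
      simp only [Tm.subst, Tm.rsusp, CaTT.Tm.subst]
      congr 1
      funext i
      simp only [CaTT.Ctx.red, CaTT.Tm.subst]
      rw [Ctx.rsub_subst]
      congr 1
      funext j
      exact Tm.rsusp_wk_hom Γ B v w (γ j)

theorem Ty.rsusp_wk_hom {n : ℕ} (Γ : Ctx n) (B : Ty n) (v w : Tm n) :
    ∀ A : Ty n, (A.subst wk).rsusp (Γ.snoc (.hom B v w)) = (A.rsusp Γ).subst CaTT.wk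
  | .unit => rfl
  | .hom A t u => by
      simp only [Ty.subst, Ty.rsusp, Tm.rsusp_wk_hom, Ty.rsusp_wk_hom Γ B v w A]
      rfl

theorem Ctx.get_rsusp_point : ∀ {n : ℕ} (Γ : Ctx n), Γ.rsusp.get Γ.point = .obj
  | _, .nil => rfl
  | _, .snoc Γ .unit => Γ.get_rsusp_point
  | _, .snoc Γ (.hom _ _ _) => by
      simp only [Ctx.rsusp, Ctx.point]
      rw [CaTT.Ctx.get_castSucc, Γ.get_rsusp_point, CaTT.Ty.subst]

theorem Ctx.get_rsusp : ∀ {n : ℕ} (Γ : Ctx n) (i : Fin n),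
    Γ.rsusp.get (Γ.rvar i) = (Γ.get i).rsusp Γ
  | _, .nil, i => i.elim0
  | _, .snoc Γ .unit, i => by
      refine Fin.lastCases ?_ (fun j => ?_) i
      · rw [Ctx.get_last]
        simp only [Ctx.rsusp, Ctx.rvar, snocFun_last]
        exact Γ.get_rsusp_point
      · rw [Ctx.get_castSucc, Ty.rsusp_wk_unit]
        simp only [Ctx.rsusp, Ctx.rvar, snocFun_castSucc]
        exact Γ.get_rsusp j
  | _, .snoc Γ (.hom B v w), i => by
      refine Fin.lastCases ?_ (fun j => ?_) i
      · rw [Ctx.get_last, Ty.rsusp_wk_hom]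
        simp only [Ctx.rsusp, Ctx.rvar, snocFun_last]
        exact CaTT.Ctx.get_last _ _
      · rw [Ctx.get_castSucc, Ty.rsusp_wk_hom]
        simp only [Ctx.rsusp, Ctx.rvar, snocFun_castSucc]
        rw [CaTT.Ctx.get_castSucc, Γ.get_rsusp j]

end MCaTT

namespace CaTT

open Judgment

theorem Derivable.get : ∀ {n : ℕ} {Γ : Ctx n}, Derivable (ctx Γ) →
    ∀ i, Derivable (ty Γ (Γ.get i))
  | _, .nil, _, i => i.elim0
  | _, .snoc Γ A, h, i => by
      have hA := h.ty_of_ctx_snoc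
      refine Fin.lastCases ?_ (fun j => ?_) i
      · rw [Ctx.get_last]
        exact hA.stable hA.wk
      · rw [Ctx.get_castSucc]
        exact (Derivable.get hA.presup j).stable hA.wk

theorem Derivable.ty_of_tm {n : ℕ} {Γ : Ctx n} {t : Tm n} {A : Ty n}
    (h : Derivable (tm Γ t A)) : Derivable (ty Γ A) := by
  cases h with
  | var i h => exact h.get i
  | constr_intro hv hγ => exact hv.presup.stable hγ

/-- The action of the substitution `red` on derivable terms and substitutions. -/
def RedOk : Judgment → Prop
  | .tm Γ t _ => t.subst Γ.red = t.desusp.rsusp Γ.desusp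
  | .sub Δ γ _ => ∀ i, (γ i).subst Δ.red = (γ i).desusp.rsusp Δ.desusp
  | _ => True

theorem Derivable.redOk {J : Judgment} (h : Derivable J) : RedOk J := by
  induction h with
  | var => rfl
  | constr_intro hv hγ _ ih =>
      simp only [RedOk, Tm.subst, Tm.desusp, MCaTT.Tm.rsusp]
      congr 1
      funext i
      rw [ih i]
      exact (MCaTT.Ctx.rsub_rvar _ _ _ (fun i hi =>
        MCaTT.Derivable.rsusp_sub (Derivable.desusp hγ) i hi) i).symm
  | es => exact fun i => i.elim0
  | se _ _ _ ih₁ _ ih₂ =>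
      intro i
      refine Fin.lastCases ?_ (fun j => ?_) i
      · rw [snocFun_last]
        exact ih₂
      · rw [snocFun_castSucc]
        exact ih₁ j
  | _ => trivial

theorem Derivable.ty_subst_red {n : ℕ} {Γ : Ctx n} : ∀ {A : Ty n}, Derivable (ty Γ A) →
    A.subst Γ.red = A.desusp.rsusp Γ.desusp
  | .obj, _ => rfl
  | .hom A t u, h => by
      cases h with
      | hom_intro ht hu =>
          have h₁ : t.subst Γ.red = _ := ht.redOk
          have h₂ : u.subst Γ.red = _ := hu.redOk
          simp only [Ty.subst, Ty.desusp, MCaTT.Ty.rsusp, h₁, h₂, ht.ty_of_tm.ty_subst_red]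

theorem Derivable.red {n : ℕ} {Γ : Ctx n} (h : Derivable (ctx Γ))
    (h' : Derivable (ctx Γ.desusp.rsusp)) : Derivable (sub Γ.desusp.rsusp Γ.red Γ) := by
  refine .sub_of_forall h' h fun i => ?_
  rw [(h.get i).ty_subst_red, ← Ctx.get_desusp, ← MCaTT.Ctx.get_rsusp]
  exact .var _ h'

end CaTT

namespace MCaTT

open Judgment

/-- Reduced suspension sends derivable judgments of MCaTT to derivable judgments of CaTT, and
definitional equalities to equalities. -/
def RsuspOk : Judgment → Prop
  | ctx Γ => CaTT.Derivable (.ctx Γ.rsusp)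
  | ty Γ A => CaTT.Derivable (.ty Γ.rsusp (A.rsusp Γ))
  | tm Γ t A => CaTT.Derivable (.tm Γ.rsusp (t.rsusp Γ) (A.rsusp Γ))
  | sub Δ γ Γ => CaTT.Derivable (.sub Δ.rsusp (rsuspSub Δ γ Γ) Γ.rsusp)
  | eqTy Γ A B => A.rsusp Γ = B.rsusp Γ
  | eqTm Γ t u _ => t.rsusp Γ = u.rsusp Γ
  | eqSub Δ γ δ _ => ∀ i, (γ i).rsusp Δ = (δ i).rsusp Δ

theorem rsuspSub_snoc_unit {m n : ℕ} (Δ : Ctx m) (γ : Fin n → Tm m) (t : Tm m) (Γ : Ctx n) :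
    rsuspSub Δ (snocFun γ t) (Γ.snoc .unit) = rsuspSub Δ γ Γ := by
  simp [rsuspSub, Ctx.rsub]

theorem rsuspSub_snoc_hom {m n : ℕ} (Δ : Ctx m) (γ : Fin n → Tm m) (t : Tm m) (Γ : Ctx n)
    (B : Ty n) (v w : Tm n) :
    rsuspSub Δ (snocFun γ t) (Γ.snoc (.hom B v w)) =
      snocFun (rsuspSub Δ γ Γ) (t.rsusp Δ) := by
  simp [rsuspSub, Ctx.rsub]

theorem Derivable.rsusp {J : Judgment} (h : Derivable J) : RsuspOk J := by
  induction h with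
  | ec => exact .ce (.obj_intro .ec)
  | @ce n Γ A _ ih =>
      cases A with
      | unit => exact CaTT.Derivable.presup ih
      | hom => exact .ce ih
  | unit_intro _ ih => exact .obj_intro ih
  | hom_intro _ _ _ _ ih₂ ih₃ => exact .hom_intro ih₂ ih₃
  | @var n Γ i _ ih =>
      simp only [RsuspOk]
      rw [← Ctx.get_rsusp]
      exact .var _ ih
  | @star_intro n Γ _ ih =>
      have h := CaTT.Derivable.var Γ.point ih
      rwa [Ctx.get_rsusp_point] at h
  | @constr_intro m n Δ Γ c A γ hv hγ ih =>
      have ih : CaTT.Derivable (.sub Δ.rsusp (rsuspSub Δ γ Γ.desusp) Γ.desusp.rsusp) := ih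
      have hA : CaTT.Derivable (.ty Γ A) := hv.presup
      have hred := CaTT.Derivable.red hA.presup ih.presup.2.1
      have h := CaTT.Derivable.constr_intro hv (hred.stable ih)
      rw [← CaTT.Ty.subst_subst, hA.ty_subst_red,
        ← Ty.rsusp_subst Δ Γ.desusp γ hγ.rsusp_sub] at h
      exact h
  | @es m Δ γ _ ih =>
      refine .sub_of_forall ih (.ce (.obj_intro .ec)) fun i => ?_
      have h := CaTT.Derivable.var Δ.point ih
      rw [Ctx.get_rsusp_point] at h
      rw [Subsingleton.elim i (Fin.last 0)]
      exact h
  | @se m n Δ Γ γ A t hγ _ _ ih₁ ih₂ ih₃ =>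
      simp only [RsuspOk]
      cases A with
      | unit =>
          rw [rsuspSub_snoc_unit]
          exact ih₁
      | hom B v w =>
          rw [rsuspSub_snoc_hom]
          refine .se ih₁ ih₂ ?_
          rw [← Ty.rsusp_subst Δ Γ γ hγ.rsusp_sub]
          exact ih₃
  | @conv n Γ t A B _ _ ih₁ ih₂ =>
      have h : A.rsusp Γ = B.rsusp Γ := ih₂
      simp only [RsuspOk] at ih₁ ⊢
      rwa [← h]
  | eta h₁ h₂ => exact h₁.rsusp_of_unit.trans h₂.rsusp_of_unit.symm
  | eqTy_refl => exact rfl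
  | eqTy_symm _ ih => exact ih.symm
  | eqTy_trans _ _ ih₁ ih₂ => exact ih₁.trans ih₂
  | eqTy_hom _ _ _ ih₁ ih₂ ih₃ =>
      simp only [RsuspOk] at ih₁ ih₂ ih₃
      simp only [RsuspOk, Ty.rsusp, ih₁, ih₂, ih₃]
  | eqTm_refl => exact rfl
  | eqTm_symm _ ih => exact ih.symm
  | eqTm_trans _ _ ih₁ ih₂ => exact ih₁.trans ih₂
  | eqTm_conv _ _ ih => exact ih
  | eqTm_constr _ _ ih =>
      simp only [RsuspOk] at ih
      simp only [RsuspOk, Tm.rsusp, ih]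
  | eqSub_nil => exact fun i => i.elim0
  | eqSub_snoc _ _ _ ih₁ _ ih₂ =>
      intro i
      refine Fin.lastCases ?_ (fun j => ?_) i
      · simp only [snocFun_last]
        exact ih₂
      · simp only [snocFun_castSucc]
        exact ih₁ j

theorem Ctx.eq_point_or : ∀ {n : ℕ} (Γ : Ctx n) (j : Fin Γ.rlen),
    j = Γ.point ∨ ∃ i, j = Γ.rvar i
  | _, .nil, j => .inl (Subsingleton.elim (α := Fin 1) _ _)
  | _, .snoc Γ .unit, j => by
      rcases Γ.eq_point_or j with h | ⟨i, h⟩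
      · exact .inl h
      · exact .inr ⟨i.castSucc, by simp [Ctx.rvar, h]⟩
  | _, .snoc Γ (.hom _ _ _), j => by
      refine Fin.lastCases ?_ (fun j => ?_) j
      · exact .inr ⟨Fin.last _, by simp [Ctx.rvar]⟩
      · rcases Γ.eq_point_or j with h | ⟨i, h⟩
        · exact .inl (by simp [Ctx.point, h])
        · exact .inr ⟨i.castSucc, by simp [Ctx.rvar, h]⟩

theorem rsuspSub_nu {n : ℕ} (Γ : Ctx n) : rsuspSub Γ Γ.nu Γ = .var := by
  have h : ∀ i, (Γ.nu i).rsusp Γ = .var (Γ.rvar i) := fun i => by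
    rcases Γ.nu_cases i with ⟨h₁, h₂⟩ | ⟨_, h₂⟩
    · rw [h₂, Tm.rsusp, Γ.rvar_of_unit i h₁]
    · rw [h₂, Tm.rsusp]
  funext j
  simp only [rsuspSub, h]
  rcases Γ.eq_point_or j with rfl | ⟨i, rfl⟩
  · exact Ctx.rsub_point _ Γ _
  · exact Ctx.rsub_rvar _ Γ _ (fun i hi => by rw [Γ.rvar_of_unit i hi]) i

end MCaTT

/-- The reduced suspension functor from the syntactic category of MCaTT to that of CaTT. -/
def reducedSuspension : MCaTT.Syn ⥤ CaTT.Syn where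
  obj Γ := ⟨Γ.ctx.rsusp, Γ.ok.rsusp⟩
  map {Δ Γ} f := ⟨MCaTT.rsuspSub Δ.ctx f.toFun Γ.ctx, f.ok.rsusp⟩
  map_id Γ := CaTT.Syn.Hom.ext (MCaTT.rsuspSub_nu Γ.ctx)
  map_comp {X Y Z} f g := CaTT.Syn.Hom.ext (by
    funext j
    refine Eq.trans ?_ (MCaTT.Ctx.rsub_subst (.var Y.ctx.point)
      (MCaTT.rsuspSub X.ctx f.toFun Y.ctx) Z.ctx (fun i => (g.toFun i).rsusp Y.ctx) j).symm
    have h : (CaTT.Tm.var Y.ctx.point).subst (MCaTT.rsuspSub X.ctx f.toFun Y.ctx) =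
      .var X.ctx.point := MCaTT.Ctx.rsub_point _ Y.ctx _
    simp only [h, ← MCaTT.Tm.rsusp_subst X.ctx Y.ctx f.toFun f.ok.rsusp_sub]
    rfl)

/-! ## Models -/

universe w

/-- A functor to sets is a model if it preserves the terminal object and sends all the pullbacks
along display maps to pullbacks. -/
def isModel {C : Type} [Category.{0} C] (display : MorphismProperty C) :
    ObjectProperty (C ⥤ Type w) := fun F =>
  (∀ X : C, Nonempty (IsTerminal X) → Nonempty (IsTerminal (F.obj X))) ∧
  ∀ ⦃P X Y Z : C⦄ (fst : P ⟶ X) (snd : P ⟶ Y) (π : X ⟶ Z) (f : Y ⟶ Z), display π →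
    IsPullback fst snd π f → IsPullback (F.map fst) (F.map snd) (F.map π) (F.map f)

/-- The property of being a set-theoretic model of MCaTT. -/
def MCaTT.isModel : ObjectProperty (MCaTT.Syn ⥤ Type w) := _root_.isModel MCaTT.displayMaps

/-- The property of being a set-theoretic model of CaTT. -/
def CaTT.isModel : ObjectProperty (CaTT.Syn ⥤ Type w) := _root_.isModel CaTT.displayMaps

/-- The property of being a model of CaTT with exactly one `0`-cell. -/
def CaTT.isOneObjectModel : ObjectProperty (CaTT.Syn ⥤ Type w) := fun F =>
  CaTT.isModel F ∧ Nonempty (Unique (F.obj CaTT.Syn.disk0))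

-- The two composites of ↓ and ↑ come with natural comparison maps, `correctionTrans : ↓↑Γ ⟶ Γ` in
-- Syn(MCaTT) and `reductionTrans : ↑↓Γ ⟶ Γ` in Syn(CaTT). Precomposing models with them gives the
-- two natural isomorphisms of the equivalence.
--
-- The correction is invertible already in Syn(MCaTT): ↓↑ exchanges the variables of type `unit` of
-- Γ for the single variable •, again of type `unit`, and by eta such variables carry no
-- information. The reduction is not invertible in Syn(CaTT): at the empty context it is the map
-- from (• : ⋆) to ∅. A model F with exactly one 0-cell nevertheless inverts it, because F cannot
-- distinguish variables of type ⋆ from •.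
--
-- Both invertibility statements are inductions on the context. For the empty context both ends
-- become terminal. For a new variable of type ⋆ or `unit` the projections on both sides become
-- isomorphisms, and naturality transfers invertibility from the shorter context. For a new variable
-- of arrow type the naturality square of the projection is a pullback
-- (`isPullback_reductionTrans_proj_hom`, `isPullback_correctionTrans_proj_hom`), so the new
-- component is a base change of the old one.
--
-- That precomposition preserves models rests on explicit pullbacks of display maps, recognised by
-- `Syn.isPullback_proj` in each theory. Desuspension preserves the empty context, display maps and
-- these pullbacks, and makes (x : ⋆) terminal, whence the single 0-cell. Reduced suspension sends a
-- display map of arrow type to a display map and one of type `unit` to an identity. It sends ∅ to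
-- (• : ⋆), not to a terminal object; this is where the hypothesis of one 0-cell enters.

/-- Whether a functor preserves the pullbacks of a cospan can be checked on one pullback square. -/
theorem isPullback_map_of_isPullback_map {C D : Type*} [Category C] [Category D] (G : C ⥤ D)
    {P P' X Y Z : C} {fst : P ⟶ X} {snd : P ⟶ Y} {fst' : P' ⟶ X} {snd' : P' ⟶ Y} {π : X ⟶ Z}
    {f : Y ⟶ Z} (h : IsPullback fst snd π f) (h' : IsPullback fst' snd' π f)
    (hG : IsPullback (G.map fst') (G.map snd') (G.map π) (G.map f)) :
    IsPullback (G.map fst) (G.map snd) (G.map π) (G.map f) := by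
  refine hG.of_iso (G.mapIso (h'.isoIsPullback _ _ h)) (Iso.refl _) (Iso.refl _) (Iso.refl _)
    ?_ ?_ (by simp) (by simp)
  · simp [← G.map_comp]
  · simp [← G.map_comp]

-- Pullbacks of display maps in Syn(CaTT)

namespace CaTT

open Judgment

theorem Tm.subst_wk_snoc {m n : ℕ} (γ : Fin n → Tm m) (t : Tm m) (u : Tm n) :
    (u.subst wk).subst (snocFun γ t) = u.subst γ := by
  rw [Tm.subst_subst]
  congr 1
  funext i
  simp [wk, Tm.subst]

@[simp] theorem Syn.comp_toFun {X Y Z : Syn} (f : X ⟶ Y) (g : Y ⟶ Z) (i : Fin Z.len) :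
    Syn.Hom.toFun (f ≫ g) i = (g.toFun i).subst f.toFun := rfl

/-- The empty context. -/
def Syn.nil : Syn := ⟨.nil, .ec⟩

/-- The empty context is terminal. -/
def Syn.isTerminalNil : IsTerminal Syn.nil :=
  IsTerminal.ofUniqueHom (fun X => ⟨Fin.elim0, .es X.ok⟩)
    (fun _ _ => Syn.Hom.ext (funext fun i => Fin.elim0 i))

/-- The square that exhibits the extension of `Y` by `A[f]` as a pullback of a display map. -/
theorem Syn.isPullback_proj {Y Z : Syn} {A : Ty Z.len} {B : Ty Y.len}
    {hA : Derivable (.ty Z.ctx A)} {hB : Derivable (.ty Y.ctx B)} (f : Y ⟶ Z)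
    (hAB : A.subst f.toFun = B) (g : Y.ext B hB ⟶ Z.ext A hA)
    (h₁ : ∀ i : Fin Z.len, g.toFun i.castSucc = (f.toFun i).subst wk)
    (h₂ : g.toFun (Fin.last _) = .var (Fin.last _)) :
    IsPullback g (Y.proj B hB) (Z.proj A hA) f := by
  have w : g ≫ Z.proj A hA = Y.proj B hB ≫ f := Syn.Hom.ext (funext fun i => h₁ i)
  have hc (s : PullbackCone (Z.proj A hA) f) (i : Fin Z.len) :
      s.fst.toFun i.castSucc = (f.toFun i).subst s.snd.toFun :=
    congrFun (congrArg Syn.Hom.toFun s.condition) i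
  refine ⟨⟨w⟩, ⟨PullbackCone.IsLimit.mk w
    (fun s => ⟨snocFun s.snd.toFun (s.fst.toFun (Fin.last _)), .se s.snd.ok hB ?_⟩)
    (fun s => ?_) (fun s => ?_) (fun s m hm₁ hm₂ => ?_)⟩⟩
  · have h := s.fst.ok.presup.2.2 (Fin.last _)
    rw [Ctx.get_last, Ty.subst_subst] at h
    -- The last entry of `s.fst` has type A pulled back along `s.fst` followed by the projection. By
    -- commutativity of the cone this is A[f][snd] = B[snd], the type needed to append the entry to
    -- `s.snd`.
    have e : (fun i => (wk i).subst s.fst.toFun) = fun i => (f.toFun i).subst s.snd.toFun :=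
      funext (hc s)
    rwa [e, ← Ty.subst_subst, hAB] at h
  · refine Syn.Hom.ext (funext fun i => ?_)
    refine Fin.lastCases ?_ (fun j => ?_) i
    · simp [h₂, Tm.subst]
    · simp [h₁, Tm.subst_wk_snoc, hc]
  · refine Syn.Hom.ext (funext fun i => ?_)
    simp [Syn.proj, wk, Tm.subst]
  · refine Syn.Hom.ext (funext fun i => ?_)
    refine Fin.lastCases ?_ (fun j => ?_) i
    -- A map into the extension of Y is determined by its last entry, which the first leg reads off,
    -- and by its other entries, which the projection reads off.
    · have h := congrFun (congrArg Syn.Hom.toFun hm₁) (Fin.last _)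
      rw [Syn.comp_toFun, h₂] at h
      simpa [Tm.subst] using h
    · have h := congrFun (congrArg Syn.Hom.toFun hm₂) j
      simpa [Syn.proj, wk, Tm.subst] using h

/-- The extension of a substitution `f` from `Y` to `Z` to a substitution from `(Y, x : A[f])` to
`(Z, x : A)`. -/
def Syn.lift {Y Z : Syn} (f : Y ⟶ Z) (A : Ty Z.len) (hA : Derivable (.ty Z.ctx A)) :
    Y.ext (A.subst f.toFun) (hA.stable f.ok) ⟶ Z.ext A hA :=
  have hB : Derivable (.ty Y.ctx (A.subst f.toFun)) := hA.stable f.ok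
  ⟨snocFun (fun i => (f.toFun i).subst wk) (.var (Fin.last _)), .se (f.ok.stable hB.wk) hA (by
    have h := Derivable.var (Fin.last _) hB.wk.presup.1
    rwa [Ctx.get_last, Ty.subst_subst] at h)⟩

theorem Syn.isPullback_lift {Y Z : Syn} (f : Y ⟶ Z) (A : Ty Z.len)
    (hA : Derivable (.ty Z.ctx A)) :
    IsPullback (Syn.lift f A hA) (Y.proj _ (hA.stable f.ok)) (Z.proj A hA) f :=
  Syn.isPullback_proj f rfl _ (fun _ => snocFun_castSucc _ _ _) (snocFun_last _ _)

end CaTT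

-- Pullbacks of display maps in Syn(MCaTT), with normal forms

namespace MCaTT

open Judgment

@[simp] theorem Syn.comp_toFun {X Y Z : Syn} (f : X ⟶ Y) (g : Y ⟶ Z) (i : Fin Z.len) :
    Syn.Hom.toFun (f ≫ g) i = (g.toFun i).subst f.toFun := rfl

/-- The empty context. -/
def Syn.nil : Syn := ⟨.nil, .ec, rfl⟩

/-- The empty context is terminal. -/
def Syn.isTerminalNil : IsTerminal Syn.nil :=
  IsTerminal.ofUniqueHom (fun X => ⟨Fin.elim0, .es X.ok, fun i => Fin.elim0 i⟩)
    (fun _ _ => Syn.Hom.ext (funext fun i => Fin.elim0 i))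

theorem Syn.nu_subst {X Y : Syn} (f : X ⟶ Y) (i : Fin Y.len) :
    (Y.ctx.nu i).subst f.toFun = f.toFun i :=
  f.ok.nu_subst f.normal i

/-- The projection has normalised variables as entries, not bare ones. A normal substitution absorbs
this normalisation, so composing with the projection still just forgets the last entry. -/
theorem Syn.comp_proj_toFun {X Z : Syn} {A : Ty Z.len} {hA : Derivable (.ty Z.ctx A)}
    {hn : A.subst Z.ctx.nu = A} (f : X ⟶ Z.ext A hA hn) (i : Fin Z.len) :
    Syn.Hom.toFun (f ≫ Z.proj A hA hn) i = f.toFun i.castSucc := by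
  rw [← Syn.nu_subst f i.castSucc, Syn.comp_toFun]
  simp only [Ctx.nu_castSucc]
  rfl

/-- Dual to the previous statement: the normalised variables in the projection have no effect on
entries that are already normal, so what remains is plain weakening. -/
theorem Syn.toFun_subst_proj {Y Z : Syn} {B : Ty Y.len} {hB : Derivable (.ty Y.ctx B)}
    {hn : B.subst Y.ctx.nu = B} (f : Y ⟶ Z) (i : Fin Z.len) :
    Syn.Hom.toFun (Y.proj B hB hn ≫ f) i = (f.toFun i).subst wk := by
  conv_rhs => rw [← f.normal i, Tm.subst_subst]
  rfl

/-- The square that exhibits the extension of `Y` by `A[f]` as a pullback of a display map. -/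
theorem Syn.isPullback_proj {Y Z : Syn} {A : Ty Z.len} {B : Ty Y.len}
    {hA : Derivable (.ty Z.ctx A)} {hB : Derivable (.ty Y.ctx B)}
    {hnA : A.subst Z.ctx.nu = A} {hnB : B.subst Y.ctx.nu = B} (f : Y ⟶ Z)
    (hAB : A.subst f.toFun = B) (g : Y.ext B hB hnB ⟶ Z.ext A hA hnA)
    (h₁ : ∀ i : Fin Z.len, g.toFun i.castSucc = (f.toFun i).subst wk)
    (h₂ : g.toFun (Fin.last _) = (Y.ctx.snoc B).nu (Fin.last _)) :
    IsPullback g (Y.proj B hB hnB) (Z.proj A hA hnA) f := by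
  have w : g ≫ Z.proj A hA hnA = Y.proj B hB hnB ≫ f := Syn.Hom.ext (funext fun i => by
    rw [Syn.comp_proj_toFun, Syn.toFun_subst_proj, h₁])
  have hc (s : PullbackCone (Z.proj A hA hnA) f) (i : Fin Z.len) :
      s.fst.toFun i.castSucc = (f.toFun i).subst s.snd.toFun := by
    rw [← Syn.comp_proj_toFun, s.condition, Syn.comp_toFun]
  have hok (s : PullbackCone (Z.proj A hA hnA) f) : Derivable (sub s.pt.ctx
      (snocFun s.snd.toFun (s.fst.toFun (Fin.last _))) (Y.ctx.snoc B)) := by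
    refine .se s.snd.ok hB ?_
    have h := s.fst.ok.presup.2.2 (Fin.last _)
    rw [Ctx.get_last, Ty.subst_subst] at h
    have e : (fun i => (wk i).subst s.fst.toFun) = fun i => (f.toFun i).subst s.snd.toFun :=
      funext (hc s)
    rwa [e, ← Ty.subst_subst, hAB] at h
  have hn (s : PullbackCone (Z.proj A hA hnA) f) (i : Fin (Y.len + 1)) :
      (snocFun s.snd.toFun (s.fst.toFun (Fin.last _)) i).subst s.pt.ctx.nu =
        snocFun s.snd.toFun (s.fst.toFun (Fin.last _)) i := by
    refine Fin.lastCases ?_ (fun j => ?_) i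
    · simpa using s.fst.normal (Fin.last _)
    · simpa using s.snd.normal j
  refine ⟨⟨w⟩, ⟨PullbackCone.IsLimit.mk w
    (fun s => ⟨snocFun s.snd.toFun (s.fst.toFun (Fin.last _)), hok s, hn s⟩)
    (fun s => ?_) (fun s => ?_) (fun s m hm₁ hm₂ => ?_)⟩⟩
  · refine Syn.Hom.ext (funext fun i => ?_)
    refine Fin.lastCases ?_ (fun j => ?_) i
    · rw [Syn.comp_toFun, h₂]
      -- The last entry of `g` is the normal form of a variable, possibly `()`. It still evaluates
      -- to the last entry of the mediating map, since a normal derivable substitution absorbs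
      -- normalisation of its codomain.
      simpa using Derivable.nu_subst (hok s) (hn s) (Fin.last _)
    · simp [h₁, Tm.subst_wk_snoc, hc]
  · refine Syn.Hom.ext (funext fun i => ?_)
    exact (Syn.comp_proj_toFun _ i).trans (snocFun_castSucc _ _ _)
  · refine Syn.Hom.ext (funext fun i => ?_)
    refine Fin.lastCases ?_ (fun j => ?_) i
    · have h := congrFun (congrArg Syn.Hom.toFun hm₁) (Fin.last _)
      rw [Syn.comp_toFun, h₂] at h
      simpa using (Syn.nu_subst m (Fin.last _)).symm.trans h
    · have h := congrFun (congrArg Syn.Hom.toFun hm₂) j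
      rw [Syn.comp_proj_toFun] at h
      simpa using h

/-- The extension of a substitution `f` from `Y` to `Z` to a substitution from `(Y, x : A[f])` to
`(Z, x : A)`. -/
def Syn.lift {Y Z : Syn} (f : Y ⟶ Z) (A : Ty Z.len) (hA : Derivable (.ty Z.ctx A))
    (hnA : A.subst Z.ctx.nu = A) :
    Y.ext (A.subst f.toFun) (hA.stable f.ok) (by simp only [Ty.subst_subst, f.normal]) ⟶
      Z.ext A hA hnA :=
  have hB : Derivable (.ty Y.ctx (A.subst f.toFun)) := hA.stable f.ok
  have hnB : (A.subst f.toFun).subst Y.ctx.nu = A.subst f.toFun := by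
    simp only [Ty.subst_subst, f.normal]
  -- The new variable enters in normal form: it is `()` when the type is `unit`.
  ⟨snocFun (fun i => (f.toFun i).subst wk) ((Y.ctx.snoc (A.subst f.toFun)).nu (Fin.last _)),
    .se (f.ok.stable hB.wk) hA (by
      have h := (Y.ext _ hB hnB).nu_ok.presup.2.2 (Fin.last _)
      rwa [Ctx.get_last, Ctx.subst_wk_nu, hnB, Ty.subst_subst] at h), fun i => by
      refine Fin.lastCases ?_ (fun j => ?_) i
      · simpa using (Y.ctx.snoc (A.subst f.toFun)).nu_nu (Fin.last _)
      · simp only [snocFun_castSucc]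
        rw [← f.normal j]
        simp only [Tm.subst_subst]
        congr 1
        funext k
        rw [← Tm.subst_subst, Ctx.proj_normal]⟩

theorem Syn.isPullback_lift {Y Z : Syn} (f : Y ⟶ Z) (A : Ty Z.len)
    (hA : Derivable (.ty Z.ctx A)) (hnA : A.subst Z.ctx.nu = A) :
    IsPullback (Syn.lift f A hA hnA) (Y.proj _ (hA.stable f.ok)
      (by simp only [Ty.subst_subst, f.normal])) (Z.proj A hA hnA) f :=
  Syn.isPullback_proj f rfl _ (fun _ => snocFun_castSucc _ _ _) (snocFun_last _ _)

/-- A substitution into a context that is extended by a variable of type unit is determined by its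
restriction. -/
theorem Syn.isIso_proj_unit (Γ : Syn) (hA : Derivable (.ty Γ.ctx .unit))
    (hn : (Ty.unit).subst Γ.ctx.nu = .unit) : IsIso (Γ.proj .unit hA hn) := by
  let s : Γ ⟶ Γ.ext .unit hA hn :=
    ⟨snocFun Γ.ctx.nu .star, .se Γ.nu_ok hA (.star_intro Γ.ok), fun i => by
      refine Fin.lastCases ?_ (fun j => ?_) i
      · simp [Tm.subst]
      · simpa using Γ.ctx.nu_nu j⟩
  refine ⟨s, Syn.Hom.ext (funext fun i => ?_), Syn.Hom.ext (funext fun i => ?_)⟩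
  -- The identity of the extended context is its normalisation, whose last entry is `()`. Hence
  -- appending `()` after projecting loses nothing.
  · change (snocFun Γ.ctx.nu Tm.star i).subst _ = (Γ.ctx.snoc .unit).nu i
    refine Fin.lastCases ?_ (fun j => ?_) i
    · simp [Tm.subst, Ctx.nu]
    · rw [snocFun_castSucc, Ctx.nu_castSucc]
      exact Syn.toFun_subst_proj (𝟙 Γ) j
  · rw [Syn.comp_proj_toFun]
    exact snocFun_castSucc _ _ _

end MCaTT

/-! ## Desuspension and display maps -/

/-- The normalisation of an extended context restricts to the weakened normalisation of the base, so
↓ carries a projection to the projection for the normalised desuspended type. -/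
theorem desuspension_map_proj (Γ : CaTT.Syn) (A : CaTT.Ty Γ.len)
    (hA : CaTT.Derivable (.ty Γ.ctx A)) :
    desuspension.map (Γ.proj A hA) = (desuspension.obj Γ).proj (A.desusp.subst Γ.ctx.desusp.nu)
      (MCaTT.Derivable.stable hA.desusp (MCaTT.Derivable.nu Γ.ok.desusp))
      (by
        change (A.desusp.subst Γ.ctx.desusp.nu).subst Γ.ctx.desusp.nf.nu = _
        simp only [MCaTT.Ctx.nu_nf, MCaTT.Ty.subst_subst, MCaTT.Ctx.nu_nu]
        rfl) :=
  MCaTT.Syn.Hom.ext (funext fun (i : Fin Γ.len) => by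
    change (Γ.ctx.desusp.snoc A.desusp).nu i.castSucc = (Γ.ctx.desusp.nf.nu i).subst MCaTT.wk
    rw [MCaTT.Ctx.nu_castSucc, MCaTT.Ctx.nu_nf])

/-- Desuspension commutes with substitution up to normal form, so the image of the explicit square
meets the criterion `MCaTT.Syn.isPullback_proj`. The image need not be the explicit square by
definition, which is why that criterion takes the top map and the type as variables subject to
equations. -/
theorem isPullback_desuspension_map_lift {Y Z : CaTT.Syn} (f : Y ⟶ Z) (A : CaTT.Ty Z.len)
    (hA : CaTT.Derivable (.ty Z.ctx A)) :
    IsPullback (desuspension.map (CaTT.Syn.lift f A hA))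
      (desuspension.map (Y.proj _ (hA.stable f.ok))) (desuspension.map (Z.proj A hA))
      (desuspension.map f) := by
  rw [desuspension_map_proj, desuspension_map_proj]
  -- The type over Z is normalised before ↓f acts on it; ↓f absorbs this normalisation.
  have hf : ∀ j : Fin Z.len, (Z.ctx.desusp.nu j).subst
      (fun i => (f.toFun i).desusp.subst Y.ctx.desusp.nu) =
        (f.toFun j).desusp.subst Y.ctx.desusp.nu := fun j => by
    have h := MCaTT.Syn.nu_subst (desuspension.map f) j
    change (Z.ctx.desusp.nf.nu j).subst _ = _ at h
    rwa [MCaTT.Ctx.nu_nf] at h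
  refine MCaTT.Syn.isPullback_proj (desuspension.map f) ?_ _ (fun (i : Fin Z.len) => ?_) ?_
  · change (A.desusp.subst Z.ctx.desusp.nu).subst
      (fun i => (f.toFun i).desusp.subst Y.ctx.desusp.nu) =
        (A.subst f.toFun).desusp.subst Y.ctx.desusp.nu
    rw [MCaTT.Ty.subst_subst, CaTT.Ty.desusp_subst, MCaTT.Ty.subst_subst]
    congr 1
    funext j
    exact hf j
  · change (snocFun (fun i => (f.toFun i).subst CaTT.wk) (.var (Fin.last Y.len))
      i.castSucc).desusp.subst (Y.ctx.desusp.snoc (A.subst f.toFun).desusp).nu =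
        ((f.toFun i).desusp.subst Y.ctx.desusp.nu).subst MCaTT.wk
    rw [snocFun_castSucc, CaTT.Tm.desusp_subst, MCaTT.Tm.subst_subst, MCaTT.Tm.subst_subst]
    congr 1
    funext j
    exact MCaTT.Ctx.nu_castSucc _ _ j
  · change (snocFun (fun i => (f.toFun i).subst CaTT.wk) (.var (Fin.last Y.len))
      (Fin.last Z.len)).desusp.subst (Y.ctx.desusp.snoc (A.subst f.toFun).desusp).nu =
        (Y.ctx.desusp.snoc (A.subst f.toFun).desusp).nf.nu (Fin.last _)
    rw [MCaTT.Ctx.nu_nf, snocFun_last]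
    rfl

/-- Desuspension preserves the pullbacks along display maps. -/
theorem isPullback_desuspension_map {P X Y Z : CaTT.Syn} {fst : P ⟶ X} {snd : P ⟶ Y} {π : X ⟶ Z}
    {f : Y ⟶ Z} (hπ : CaTT.displayMaps π) (h : IsPullback fst snd π f) :
    IsPullback (desuspension.map fst) (desuspension.map snd) (desuspension.map π)
      (desuspension.map f) := by
  cases hπ with
  | mk _ A hA =>
      exact isPullback_map_of_isPullback_map desuspension h (CaTT.Syn.isPullback_lift f A hA) (isPullback_desuspension_map_lift f A hA)

theorem displayMaps_desuspension_map {X Z : CaTT.Syn} {π : X ⟶ Z} (hπ : CaTT.displayMaps π) :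
    MCaTT.displayMaps (desuspension.map π) := by
  cases hπ with
  | mk Γ A hA =>
      rw [desuspension_map_proj]
      exact .mk _ _ _ _

/-- Desuspension sends the disk `(x : ⋆)` to a terminal object. -/
theorem nonempty_isTerminal_desuspension_disk0 :
    Nonempty (IsTerminal (desuspension.obj CaTT.Syn.disk0)) := by
  have := MCaTT.Syn.isIso_proj_unit MCaTT.Syn.nil (.unit_intro .ec) rfl
  exact ⟨MCaTT.Syn.isTerminalNil.ofIso
    (asIso (MCaTT.Syn.nil.proj .unit (.unit_intro .ec) rfl)).symm⟩

theorem isModel_desuspension_comp {F : MCaTT.Syn ⥤ Type w} (hF : MCaTT.isModel F) :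
    CaTT.isOneObjectModel (desuspension ⋙ F) := by
  refine ⟨⟨fun X ⟨hX⟩ => ?_, fun P X Y Z fst snd π f hπ h => ?_⟩, ?_⟩
  · obtain ⟨h⟩ := hF.1 _ ⟨MCaTT.Syn.isTerminalNil⟩
    -- The empty context desuspends to itself; any other terminal object is isomorphic to it.
    exact ⟨h.ofIso ((desuspension ⋙ F).mapIso (CaTT.Syn.isTerminalNil.uniqueUpToIso hX))⟩
  · exact hF.2 _ _ _ _ (displayMaps_desuspension_map hπ) (isPullback_desuspension_map hπ h)
  · obtain ⟨h⟩ := hF.1 _ nonempty_isTerminal_desuspension_disk0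
    exact ⟨Types.isTerminalEquivUnique _ h⟩

/-! ## Reduced suspension and display maps -/

/-- A variable of type `unit` leaves no trace in the reduced suspension, so weakening by it is
invisible there. -/
theorem rsuspSub_wk_unit {m n : ℕ} {Δ : MCaTT.Ctx m} (Γ : MCaTT.Ctx n) (γ : Fin n → MCaTT.Tm m) :
    MCaTT.rsuspSub (Δ.snoc .unit) (fun i => (γ i).subst MCaTT.wk) Γ = MCaTT.rsuspSub Δ γ Γ := by
  simp only [MCaTT.rsuspSub, MCaTT.Tm.rsusp_wk_unit]
  rfl

theorem rsuspSub_wk_hom {m n : ℕ} {Δ : MCaTT.Ctx m} {A : MCaTT.Ty m} {t u : MCaTT.Tm m}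
    (Γ : MCaTT.Ctx n) (γ : Fin n → MCaTT.Tm m) :
    MCaTT.rsuspSub (Δ.snoc (.hom A t u)) (fun i => (γ i).subst MCaTT.wk) Γ =
      fun i => (MCaTT.rsuspSub Δ γ Γ i).subst CaTT.wk := by
  funext i
  simp only [MCaTT.rsuspSub, MCaTT.Tm.rsusp_wk_hom, MCaTT.Ctx.rsub_subst]
  rfl

/-- The equation typechecks because ↑(Γ, x : `unit`) unfolds to ↑Γ. -/
theorem reducedSuspension_map_proj_unit (Γ : MCaTT.Syn)
    (hA : MCaTT.Derivable (.ty Γ.ctx .unit)) (hn : MCaTT.Ty.unit.subst Γ.ctx.nu = .unit) :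
    reducedSuspension.map (Γ.proj .unit hA hn) = 𝟙 (reducedSuspension.obj Γ) :=
  CaTT.Syn.Hom.ext ((rsuspSub_wk_unit Γ.ctx Γ.ctx.nu).trans (MCaTT.rsuspSub_nu Γ.ctx))

/-- The type is a variable with an equation so that the statement applies to substituted or
desuspended types that merely reduce to `unit`. -/
theorem isIso_reducedSuspension_map_proj (Γ : MCaTT.Syn) (A : MCaTT.Ty Γ.len) (h : A = .unit)
    (hA : MCaTT.Derivable (.ty Γ.ctx A)) (hn : A.subst Γ.ctx.nu = A) :
    IsIso (reducedSuspension.map (Γ.proj A hA hn)) := by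
  subst h
  rw [reducedSuspension_map_proj_unit]
  exact inferInstanceAs (IsIso (𝟙 (reducedSuspension.obj Γ)))

theorem reducedSuspension_map_proj_hom (Γ : MCaTT.Syn) (A : MCaTT.Ty Γ.len)
    (t u : MCaTT.Tm Γ.len) (hA : MCaTT.Derivable (.ty Γ.ctx (.hom A t u)))
    (hn : (MCaTT.Ty.hom A t u).subst Γ.ctx.nu = .hom A t u) :
    reducedSuspension.map (Γ.proj (.hom A t u) hA hn) =
      (reducedSuspension.obj Γ).proj (MCaTT.Ty.rsusp Γ.ctx (.hom A t u)) hA.rsusp := by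
  refine CaTT.Syn.Hom.ext ((rsuspSub_wk_hom Γ.ctx Γ.ctx.nu).trans ?_)
  rw [MCaTT.rsuspSub_nu]
  rfl

/-- A model of CaTT sends the reduced suspensions of pullbacks along display maps
to pullbacks. -/
theorem isPullback_map_reducedSuspension_map {F : CaTT.Syn ⥤ Type w} (hF : CaTT.isModel F)
    {P X Y Z : MCaTT.Syn} {fst : P ⟶ X} {snd : P ⟶ Y} {π : X ⟶ Z}
    {f : Y ⟶ Z} (hπ : MCaTT.displayMaps π) (h : IsPullback fst snd π f) :
    IsPullback ((reducedSuspension ⋙ F).map fst) ((reducedSuspension ⋙ F).map snd)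
      ((reducedSuspension ⋙ F).map π) ((reducedSuspension ⋙ F).map f) := by
  cases hπ with
  | mk _ A hA hn =>
      have hp := MCaTT.Syn.isPullback_lift f A hA hn
      refine isPullback_map_of_isPullback_map (reducedSuspension ⋙ F) h hp ?_
      have w := (reducedSuspension ⋙ F).map_commSq hp.toCommSq
      have hB : MCaTT.Derivable (.ty Y.ctx (A.subst f.toFun)) := hA.stable f.ok
      have hnB : (A.subst f.toFun).subst Y.ctx.nu = A.subst f.toFun := by
        simp only [MCaTT.Ty.subst_subst, f.normal]
      -- Over `unit` both vertical maps become isomorphisms, so commutativity suffices. Over an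
      -- arrow type the suspended square is itself a pullback along a display map of CaTT, to which
      -- the model property applies.
      cases A with
      | unit =>
          have h₁ := isIso_reducedSuspension_map_proj Z _ rfl hA hn
          have h₂ := isIso_reducedSuspension_map_proj Y _ rfl hB hnB
          have h₃ : IsIso ((reducedSuspension ⋙ F).map (Z.proj .unit hA hn)) :=
            @Functor.map_isIso _ _ _ _ _ _ F _ h₁
          have h₄ : IsIso ((reducedSuspension ⋙ F).map (Y.proj _ hB hnB)) :=
            @Functor.map_isIso _ _ _ _ _ _ F _ h₂
          exact @IsPullback.of_vert_isIso _ _ _ _ _ _ _ _ _ _ h₄ h₃ w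
      | hom B t u =>
          have e₁ := reducedSuspension_map_proj_hom Z B t u hA hn
          have e₂ := reducedSuspension_map_proj_hom Y (B.subst f.toFun) (t.subst f.toFun)
            (u.subst f.toFun) hB hnB
          have hs : IsPullback (reducedSuspension.map (MCaTT.Syn.lift f (.hom B t u) hA hn))
              ((reducedSuspension.obj Y).proj (MCaTT.Ty.rsusp Y.ctx
                ((MCaTT.Ty.hom B t u).subst f.toFun))
                hB.rsusp)
              ((reducedSuspension.obj Z).proj (MCaTT.Ty.rsusp Z.ctx (.hom B t u)) hA.rsusp)
              (reducedSuspension.map f) := by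
            have e₃ : (reducedSuspension.map (MCaTT.Syn.lift f (.hom B t u) hA hn)).toFun =
                snocFun (fun i => ((reducedSuspension.map f).toFun i).subst CaTT.wk)
                  (.var (Fin.last _)) := by
              refine (MCaTT.rsuspSub_snoc_hom _ _ _ _ _ _ _).trans ?_
              have e := rsuspSub_wk_hom (Δ := Y.ctx) (A := B.subst f.toFun)
                (t := t.subst f.toFun) (u := u.subst f.toFun) Z.ctx f.toFun
              refine congrArg₂ snocFun e ?_
              simp only [MCaTT.Ty.subst, MCaTT.Ctx.nu, snocFun_last, MCaTT.Tm.rsusp,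
                MCaTT.Ctx.rvar]
              rfl
            refine CaTT.Syn.isPullback_proj (reducedSuspension.map f) ?_ _ (fun i => ?_) ?_
            · exact (MCaTT.Ty.rsusp_subst Y.ctx Z.ctx f.toFun f.ok.rsusp_sub _).symm
            · rw [e₃]
              exact snocFun_castSucc _ _ _
            · rw [e₃]
              exact snocFun_last _ _
          have := hF.2 _ _ _ _ (.mk _ _ _) hs
          rw [← e₁] at this
          simp only [Functor.comp_map]
          refine Eq.mp ?_ this
          congr 2
          exact e₂.symm

/-- For the terminal object, ↑∅ is the disk (• : ⋆), whose value under F is a singleton exactly by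
the assumption on 0-cells. -/
theorem isModel_reducedSuspension_comp {F : CaTT.Syn ⥤ Type w} (hF : CaTT.isOneObjectModel F) :
    MCaTT.isModel (reducedSuspension ⋙ F) := by
  refine ⟨fun X ⟨hX⟩ => ?_, fun P X Y Z fst snd π f hπ h =>
    isPullback_map_reducedSuspension_map hF.1 hπ h⟩
  obtain ⟨h⟩ := hF.2
  exact ⟨((Types.isTerminalEquivUnique _).symm h).ofIso
    ((reducedSuspension ⋙ F).mapIso (MCaTT.Syn.isTerminalNil.uniqueUpToIso hX))⟩

/-! ## The comparison of a context of CaTT with the reduced suspension of its desuspension -/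

namespace CaTT

open Judgment

/-- The substitution from the reduced suspension of the normal form of the desuspension of `Γ` to
`Γ`. -/
def Ctx.redNf {n : ℕ} (Γ : Ctx n) : Fin n → Tm Γ.desusp.nf.rlen :=
  fun i => .var (Γ.desusp.nf.rvar i)

/-- The action of the substitution `redNf` on derivable terms and substitutions. -/
def RedNfOk : Judgment → Prop
  | .tm Γ t _ => t.subst Γ.redNf = (t.desusp.subst Γ.desusp.nu).rsusp Γ.desusp.nf
  | .sub Δ γ _ => ∀ i,
      (γ i).subst Δ.redNf = ((γ i).desusp.subst Δ.desusp.nu).rsusp Δ.desusp.nf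
  | _ => True

/-- Going down and up again changes a derivable term only by collapsing the variables of type ⋆ to
•. For an operation or coherence, ↑ rebuilds the arguments from those at arrow variables and puts •
elsewhere; this recovers the expected arguments because those of type ⋆ have become •. -/
theorem Derivable.redNfOk {J : Judgment} (h : Derivable J) : RedNfOk J := by
  induction h with
  | @var n Γ i _ =>
      simp only [RedNfOk, Tm.subst, Tm.desusp, MCaTT.Tm.subst, Ctx.redNf]
      rcases Γ.desusp.nu_cases i with ⟨h₁, h₂⟩ | ⟨_, h₂⟩
      · rw [h₂, MCaTT.Tm.rsusp, MCaTT.Ctx.rvar_of_unit]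
        rw [MCaTT.Ctx.get_nf, h₁, MCaTT.Ty.subst]
      · rw [h₂, MCaTT.Tm.rsusp]
  | @constr_intro m n Δ Γ c A γ hv hγ _ ih =>
      simp only [RedNfOk, Tm.subst, Tm.desusp, MCaTT.Tm.subst, MCaTT.Tm.rsusp]
      congr 1
      funext i
      rw [ih i]
      rw [Ctx.red, Tm.subst, MCaTT.Ctx.rsub_rvar]
      -- An argument of type `unit` normalises to `()`, which suspends to •.
      intro i hi
      have h := (MCaTT.Derivable.presup (Derivable.desusp hγ)).2.2 i
      rw [hi] at h
      rw [h.nf_of_unit, MCaTT.Tm.rsusp]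
  | es => exact fun i => i.elim0
  | se _ _ _ ih₁ _ ih₂ =>
      intro i
      refine Fin.lastCases ?_ (fun j => ?_) i
      · rw [snocFun_last]
        exact ih₂
      · rw [snocFun_castSucc]
        exact ih₁ j
  | _ => trivial

/-- The rule `hom_intro` of CaTT has no premise for the base type, so an induction on derivations
says nothing about it. The recursion is on the type instead, with `ty_of_tm` supplying the missing
derivation. -/
theorem Derivable.ty_subst_redNf {n : ℕ} {Γ : Ctx n} : ∀ {A : Ty n}, Derivable (ty Γ A) →
    A.subst Γ.redNf = (A.desusp.subst Γ.desusp.nu).rsusp Γ.desusp.nf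
  | .obj, _ => rfl
  | .hom A t u, h => by
      cases h with
      | hom_intro ht hu =>
          have h₁ : t.subst Γ.redNf = _ := ht.redNfOk
          have h₂ : u.subst Γ.redNf = _ := hu.redNfOk
          simp only [Ty.subst, Ty.desusp, MCaTT.Ty.subst, MCaTT.Ty.rsusp, h₁, h₂,
            ht.ty_of_tm.ty_subst_redNf]

theorem Derivable.redNf {n : ℕ} {Γ : Ctx n} (h : Derivable (ctx Γ)) :
    Derivable (sub Γ.desusp.nf.rsusp Γ.redNf Γ) := by
  have h' : Derivable (ctx Γ.desusp.nf.rsusp) :=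
    (MCaTT.Derivable.nu h.desusp).presup.1.rsusp
  refine .sub_of_forall h' h fun i => ?_
  rw [(h.get i).ty_subst_redNf, ← Ctx.get_desusp, ← MCaTT.Ctx.get_nf, ← MCaTT.Ctx.get_rsusp]
  exact .var _ h'

end CaTT

/-- The natural transformation from the reduced suspension of the desuspension of a context to this
context. -/
def reductionTrans : desuspension ⋙ reducedSuspension ⟶ 𝟭 CaTT.Syn where
  app Γ := ⟨Γ.ctx.redNf, Γ.ok.redNf⟩
  naturality {Δ Γ} f := CaTT.Syn.Hom.ext (funext fun (i : Fin Γ.len) =>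
    -- One side of the square reads off the entries of ↑↓f, those of type `unit` being •; the other
    -- is `redNfOk` for f.
    (MCaTT.Ctx.rsub_rvar _ Γ.ctx.desusp.nf
      (fun j => ((f.toFun j).desusp.subst Δ.ctx.desusp.nu).rsusp Δ.ctx.desusp.nf)
      (fun j hj => MCaTT.Derivable.rsusp_sub (desuspension.map f).ok j hj) i).trans
    (CaTT.Derivable.redNfOk f.ok i).symm)

/-- A variable of arrow type survives ↑↓, so the reduction of the extended context is that of Γ
extended by this variable. This would fail for a variable of type ⋆, which ↑↓ discards. -/
theorem isPullback_reductionTrans_proj_hom (Γ : CaTT.Syn) (A : CaTT.Ty Γ.len)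
    (t u : CaTT.Tm Γ.len) (hA : CaTT.Derivable (.ty Γ.ctx (.hom A t u))) :
    IsPullback (reductionTrans.app (Γ.ext (.hom A t u) hA))
      (reducedSuspension.map (desuspension.map (Γ.proj (.hom A t u) hA)))
      (Γ.proj (.hom A t u) hA) (reductionTrans.app Γ) := by
  rw [desuspension_map_proj]
  have hA' := MCaTT.Derivable.stable hA.desusp (MCaTT.Derivable.nu Γ.ok.desusp)
  have e := reducedSuspension_map_proj_hom (desuspension.obj Γ) _ _ _ hA' (by
    change ((CaTT.Ty.hom A t u).desusp.subst Γ.ctx.desusp.nu).subst Γ.ctx.desusp.nf.nu =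
      (CaTT.Ty.hom A t u).desusp.subst Γ.ctx.desusp.nu
    simp only [MCaTT.Ctx.nu_nf, MCaTT.Ty.subst_subst, MCaTT.Ctx.nu_nu])
  have h := CaTT.Syn.isPullback_proj (Y := reducedSuspension.obj (desuspension.obj Γ)) (Z := Γ)
    (reductionTrans.app Γ) (B := MCaTT.Ty.rsusp Γ.ctx.desusp.nf
    ((CaTT.Ty.hom A t u).desusp.subst Γ.ctx.desusp.nu)) (hA := hA) (hB := hA'.rsusp)
    hA.ty_subst_redNf (reductionTrans.app (Γ.ext (.hom A t u) hA)) (fun i => by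
      refine congrArg CaTT.Tm.var ?_
      exact snocFun_castSucc _ _ i) (by
      refine congrArg CaTT.Tm.var ?_
      exact snocFun_last _ _)
  exact Eq.mp (congrArg (fun p => IsPullback (reductionTrans.app (Γ.ext (.hom A t u) hA)) p
    (Γ.proj (.hom A t u) hA) (reductionTrans.app Γ)) e.symm) h

/-- A model of CaTT with one object sends the reduction morphisms to isomorphisms. -/
theorem isIso_map_reductionTrans_app {F : CaTT.Syn ⥤ Type w} (hF : CaTT.isOneObjectModel F) :
    ∀ {n : ℕ} (Γ : CaTT.Ctx n) (hΓ : CaTT.Derivable (.ctx Γ)),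
      IsIso (F.map (reductionTrans.app ⟨Γ, hΓ⟩))
  | _, .nil, hΓ => by
      -- Here the reduction goes from (• : ⋆) to ∅, and F sends both to singletons.
      obtain ⟨h₁⟩ := hF.1.1 CaTT.Syn.nil ⟨CaTT.Syn.isTerminalNil⟩
      obtain ⟨h₂⟩ := hF.2
      exact isIso_of_isTerminal ((Types.isTerminalEquivUnique _).symm h₂) h₁ _
  | _, .snoc Γ .obj, hΓ => by
      have hA := hΓ.ty_of_ctx_snoc
      have ih := isIso_map_reductionTrans_app hF Γ hA.presup
      let G : CaTT.Syn := ⟨Γ, hA.presup⟩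
      obtain ⟨h₁⟩ := hF.1.1 CaTT.Syn.nil ⟨CaTT.Syn.isTerminalNil⟩
      obtain ⟨h₂⟩ := hF.2
      have h₃ : IsIso (F.map (CaTT.Syn.nil.proj .obj (.obj_intro .ec))) :=
        isIso_of_isTerminal ((Types.isTerminalEquivUnique _).symm h₂) h₁ _
      -- Adjoining x : ⋆ to G is the base change of (x : ⋆) → ∅ along G → ∅, so F inverts this
      -- projection too. As ↑↓ of the projection is an isomorphism, naturality lets both be
      -- cancelled.
      have h₄ := (hF.1.2 _ _ _ _ (.mk _ _ _) (CaTT.Syn.isPullback_lift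
        (CaTT.Syn.isTerminalNil.from G) .obj (.obj_intro .ec))).isIso_snd_of_isIso h₃
      have h₅ := desuspension_map_proj G .obj hA
      have h₆ : IsIso (reducedSuspension.map (desuspension.map (G.proj .obj hA))) := by
        rw [h₅]
        exact isIso_reducedSuspension_map_proj _ _ rfl _ _
      have h₇ := @Functor.map_isIso _ _ _ _ _ _ F _ h₆
      have w := congrArg F.map (reductionTrans.naturality (G.proj .obj hA))
      rw [F.map_comp, F.map_comp] at w
      have h₈ := @IsIso.comp_isIso _ _ _ _ _ _ _ h₇ ih
      change IsIso (F.map (reducedSuspension.map (desuspension.map (G.proj .obj hA))) ≫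
        F.map (reductionTrans.app G)) at h₈
      erw [w] at h₈
      exact @IsIso.of_isIso_comp_right _ _ _ _ _ _ _ h₄ h₈
  | _, .snoc Γ (.hom A t u), hΓ => by
      have hA := hΓ.ty_of_ctx_snoc
      have ih := isIso_map_reductionTrans_app hF Γ hA.presup
      exact (hF.1.2 _ _ _ _ (.mk _ _ _)
        (isPullback_reductionTrans_proj_hom ⟨Γ, hA.presup⟩ A t u hA)).isIso_fst_of_isIso ih

/-! ## The comparison of a context of MCaTT with the desuspension of its reduced suspension -/

namespace MCaTT

open Judgment

/-- The substitution from the desuspension of the reduced suspension of `Γ` to `Γ`. -/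
def Ctx.corr {n : ℕ} (Γ : Ctx n) : Fin n → Tm Γ.rlen :=
  fun i => Γ.rsusp.desusp.nu (Γ.rvar i)

theorem Ctx.nu_desusp_rsusp_point {n : ℕ} (Γ : Ctx n) : Γ.rsusp.desusp.nu Γ.point = .star := by
  rcases Γ.rsusp.desusp.nu_cases Γ.point with ⟨_, h⟩ | ⟨h, _⟩
  · exact h
  · rw [CaTT.Ctx.get_desusp, Ctx.get_rsusp_point] at h
    exact (h rfl).elim

/-- The action of the substitution `corr` on derivable terms and substitutions. -/
def CorrOk : Judgment → Prop
  | .tm Γ t _ => t.subst Γ.corr = (t.rsusp Γ).desusp.subst Γ.rsusp.desusp.nu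
  | .sub Δ γ _ => ∀ i, (γ i).subst Δ.corr = ((γ i).rsusp Δ).desusp.subst Δ.rsusp.desusp.nu
  | .ty Γ A => A.subst Γ.corr = (A.rsusp Γ).desusp.subst Γ.rsusp.desusp.nu
  | _ => True

/-- The counterpart of `redNfOk`: here `()` goes to • and back to `()`. Types can be included in the
induction because `hom_intro` of MCaTT has a premise for the base type, and `conv` costs nothing
because the claim about a term does not involve its type. -/
theorem Derivable.corrOk {J : Judgment} (h : Derivable J) : CorrOk J := by
  induction h with
  | unit_intro => rfl
  | hom_intro _ _ _ ih₁ ih₂ ih₃ =>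
      simp only [CorrOk] at ih₁ ih₂ ih₃
      simp only [CorrOk, Ty.subst, Ty.rsusp, CaTT.Ty.desusp, ih₁, ih₂, ih₃]
  | var => rfl
  | @star_intro n Γ _ => exact Γ.nu_desusp_rsusp_point.symm
  | @constr_intro m n Δ Γ c A γ _ hγ ih =>
      simp only [CorrOk, Tm.subst, Tm.rsusp, CaTT.Tm.desusp]
      congr 1
      funext i
      rw [ih i, CaTT.Ctx.red, CaTT.Tm.subst, Ctx.rsub_rvar _ _ _ hγ.rsusp_sub]
  | conv _ _ ih => exact ih
  | es => exact fun i => i.elim0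
  | se _ _ _ ih₁ _ ih₂ =>
      intro i
      refine Fin.lastCases ?_ (fun j => ?_) i
      · rw [snocFun_last]
        exact ih₂
      · rw [snocFun_castSucc]
        exact ih₁ j
  | _ => trivial

theorem Derivable.corr {n : ℕ} {Γ : Ctx n} (h : Derivable (ctx Γ)) :
    Derivable (sub Γ.rsusp.desusp.nf Γ.corr Γ) := by
  have h' : Derivable (sub Γ.rsusp.desusp.nf Γ.rsusp.desusp.nu Γ.rsusp.desusp) :=
    Derivable.nu (CaTT.Derivable.desusp h.rsusp)
  refine .sub_of_forall h'.presup.1 h fun i => ?_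
  have e : (Γ.get i).subst Γ.corr = _ := (h.get i).corrOk
  rw [e, ← Ctx.get_rsusp, ← CaTT.Ctx.get_desusp]
  exact h'.presup.2.2 _

end MCaTT

/-- The natural transformation from the desuspension of the reduced suspension of a context to this
context. -/
def correctionTrans : reducedSuspension ⋙ desuspension ⟶ 𝟭 MCaTT.Syn where
  app Γ := ⟨Γ.ctx.corr, Γ.ok.corr, fun i => by
    change (Γ.ctx.rsusp.desusp.nu (Γ.ctx.rvar i)).subst Γ.ctx.rsusp.desusp.nf.nu = _
    rw [MCaTT.Ctx.nu_nf, MCaTT.Ctx.nu_nu]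
    rfl⟩
  naturality {Δ Γ} f := MCaTT.Syn.Hom.ext (funext fun (i : Fin Γ.len) => by
    refine Eq.trans ?_ (MCaTT.Derivable.corrOk f.ok i).symm
    have h := MCaTT.Syn.nu_subst (desuspension.map (reducedSuspension.map f)) (Γ.ctx.rvar i)
    change (Γ.ctx.rsusp.desusp.nf.nu (Γ.ctx.rvar i)).subst _ =
      (MCaTT.rsuspSub Δ.ctx f.toFun Γ.ctx (Γ.ctx.rvar i)).desusp.subst
        Δ.ctx.rsusp.desusp.nu at h
    rw [MCaTT.Ctx.nu_nf, MCaTT.rsuspSub, MCaTT.Ctx.rsub_rvar _ _ _ f.ok.rsusp_sub] at h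
    exact h)

/-- A variable of arrow type is kept by both ↑ and ↓, so the correction of the extended context is
that of Γ extended by this variable. -/
theorem isPullback_correctionTrans_proj_hom (Γ : MCaTT.Syn) (A : MCaTT.Ty Γ.len)
    (t u : MCaTT.Tm Γ.len) (hA : MCaTT.Derivable (.ty Γ.ctx (.hom A t u)))
    (hn : (MCaTT.Ty.hom A t u).subst Γ.ctx.nu = .hom A t u) :
    IsPullback (correctionTrans.app (Γ.ext (.hom A t u) hA hn))
      (desuspension.map (reducedSuspension.map (Γ.proj (.hom A t u) hA hn)))
      (Γ.proj (.hom A t u) hA hn) (correctionTrans.app Γ) := by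
  rw [reducedSuspension_map_proj_hom]
  have e := desuspension_map_proj (reducedSuspension.obj Γ)
    (MCaTT.Ty.rsusp Γ.ctx (.hom A t u)) hA.rsusp
  have h := MCaTT.Syn.isPullback_proj (correctionTrans.app Γ)
    (Y := desuspension.obj (reducedSuspension.obj Γ)) (Z := Γ) (hnA := hn)
    (B := (MCaTT.Ty.rsusp Γ.ctx (.hom A t u)).desusp.subst Γ.ctx.rsusp.desusp.nu)
    (hA := hA) (hB := MCaTT.Derivable.stable (CaTT.Derivable.desusp hA.rsusp)
      (MCaTT.Derivable.nu (CaTT.Derivable.desusp Γ.ok.rsusp)))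
    (hnB := by
      change (MCaTT.Ty.subst Γ.ctx.rsusp.desusp.nu _).subst Γ.ctx.rsusp.desusp.nf.nu = _
      simp only [MCaTT.Ctx.nu_nf, MCaTT.Ty.subst_subst, MCaTT.Ctx.nu_nu]
      rfl)
    hA.corrOk (correctionTrans.app (Γ.ext (.hom A t u) hA hn)) (fun (i : Fin Γ.len) => by
      change (Γ.ctx.rsusp.snoc (MCaTT.Ty.rsusp Γ.ctx (.hom A t u))).desusp.nu
        (snocFun (fun i => (Γ.ctx.rvar i).castSucc) (Fin.last Γ.ctx.rlen) i.castSucc) =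
          (Γ.ctx.rsusp.desusp.nu (Γ.ctx.rvar i)).subst MCaTT.wk
      rw [snocFun_castSucc]
      exact MCaTT.Ctx.nu_castSucc _ _ _) (by
      change (Γ.ctx.rsusp.desusp.snoc (MCaTT.Ty.rsusp Γ.ctx (.hom A t u)).desusp).nu
        (snocFun (fun i => (Γ.ctx.rvar i).castSucc) (Fin.last Γ.ctx.rlen) (Fin.last Γ.len)) =
          (Γ.ctx.rsusp.desusp.nf.snoc ((MCaTT.Ty.rsusp Γ.ctx (.hom A t u)).desusp.subst
            Γ.ctx.rsusp.desusp.nu)).nu (Fin.last Γ.ctx.rlen)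
      rw [snocFun_last]
      exact congrFun (MCaTT.Ctx.nu_nf (Γ.ctx.rsusp.desusp.snoc _)).symm _)
  exact Eq.mp (congrArg (fun p => IsPullback (correctionTrans.app (Γ.ext (.hom A t u) hA hn)) p
    (Γ.proj (.hom A t u) hA hn) (correctionTrans.app Γ)) e.symm) h

theorem isIso_correctionTrans_app : ∀ {n : ℕ} (Γ : MCaTT.Ctx n)
    (hΓ : MCaTT.Derivable (.ctx Γ)) (hn : Γ.nf = Γ), IsIso (correctionTrans.app ⟨Γ, hΓ, hn⟩)
  | _, .nil, hΓ, hn => by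
      obtain ⟨h⟩ := nonempty_isTerminal_desuspension_disk0
      exact isIso_of_isTerminal h MCaTT.Syn.isTerminalNil _
  | _, .snoc Γ A, hΓ, hn => by
      have hA := hΓ.ty_of_ctx_snoc
      rw [MCaTT.Ctx.nf] at hn
      -- Normality passes to the shorter context and to the last type, so the induction stays among
      -- objects of Syn(MCaTT).
      injection hn with _ hnΓ hnA
      have ih := isIso_correctionTrans_app Γ hA.presup hnΓ
      let G : MCaTT.Syn := ⟨Γ, hA.presup, hnΓ⟩
      cases A with
      | unit =>
          have h₁ := MCaTT.Syn.isIso_proj_unit G hA hnA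
          have h₂ := isIso_reducedSuspension_map_proj G _ rfl hA hnA
          have h₃ := @Functor.map_isIso _ _ _ _ _ _ desuspension _ h₂
          have w := correctionTrans.naturality (G.proj .unit hA hnA)
          have h₄ := @IsIso.comp_isIso _ _ _ _ _ _ _ h₃ ih
          -- By naturality this composite is ↓↑ of the projection followed by the correction of the
          -- shorter context, both invertible. The projection itself is invertible by eta and can be
          -- cancelled.
          have h₅ : IsIso (correctionTrans.app (G.ext .unit hA hnA) ≫ G.proj .unit hA hnA) := by
            rw [← Functor.id_map (G.proj .unit hA hnA), ← w]
            exact h₄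
          exact @IsIso.of_isIso_comp_right _ _ _ _ _ _ _ h₁ h₅
      | hom B t u =>
          exact (isPullback_correctionTrans_proj_hom G B t u hA hnA).isIso_fst_of_isIso ih

/-! ## The equivalence -/

/-- Precomposition with desuspension. -/
def desuspensionPullback :
    MCaTT.isModel.{w}.FullSubcategory ⥤ CaTT.isOneObjectModel.{w}.FullSubcategory :=
  CaTT.isOneObjectModel.{w}.lift
    (MCaTT.isModel.{w}.ι ⋙ (Functor.whiskeringLeft _ _ _).obj desuspension)
    (fun F => isModel_desuspension_comp F.property)

/-- Precomposition with reduced suspension. -/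
def reducedSuspensionPullback :
    CaTT.isOneObjectModel.{w}.FullSubcategory ⥤ MCaTT.isModel.{w}.FullSubcategory :=
  MCaTT.isModel.{w}.lift
    (CaTT.isOneObjectModel.{w}.ι ⋙ (Functor.whiskeringLeft _ _ _).obj reducedSuspension)
    (fun F => isModel_reducedSuspension_comp F.property)

/-- The restriction of the desuspension of a model of MCaTT along the reduced suspension is
isomorphic to the model. -/
noncomputable def unitIso :
    𝟭 MCaTT.isModel.{w}.FullSubcategory ≅ desuspensionPullback ⋙ reducedSuspensionPullback :=
  have : ∀ Γ, IsIso (correctionTrans.app Γ) := fun Γ =>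
    isIso_correctionTrans_app Γ.ctx Γ.ok Γ.normal
  (NatIso.ofComponents (fun F => MCaTT.isModel.isoMk
    (NatIso.ofComponents (fun Γ => F.obj.mapIso (asIso (correctionTrans.app Γ))) (fun f => by
      have h := congrArg F.obj.map (correctionTrans.naturality f)
      rw [F.obj.map_comp, F.obj.map_comp] at h
      exact h)))
    (fun {F G} α => by
      ext Γ : 3
      exact (α.hom.naturality (correctionTrans.app Γ)).symm)).symm

/-- The restriction of a model of CaTT with one object along the reduced suspension of the
desuspension is isomorphic to the model. -/
noncomputable def counitIso :
    reducedSuspensionPullback ⋙ desuspensionPullback ≅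
      𝟭 CaTT.isOneObjectModel.{w}.FullSubcategory :=
  NatIso.ofComponents (fun F => CaTT.isOneObjectModel.isoMk
    -- Only the image of the reduction under the model is invertible, so the isomorphism is formed
    -- after applying F.
    (NatIso.ofComponents (fun Γ => @asIso _ _ _ _ (F.obj.map (reductionTrans.app Γ))
      (isIso_map_reductionTrans_app F.property Γ.ctx Γ.ok)) (fun f => by
      have h := congrArg F.obj.map (reductionTrans.naturality f)
      rw [F.obj.map_comp, F.obj.map_comp] at h
      exact h)))
    (fun {F G} α => by
      ext Γ : 3
      exact (α.hom.naturality (reductionTrans.app Γ)).symm)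

/-- The two equations say that the functors of the equivalence are precomposition on the nose.
`Equivalence.mk` replaces the unit to satisfy the triangle identity but leaves both functors
untouched, so they hold by definition. -/
theorem mainTheorem2 :
    ∃ e : MCaTT.isModel.{w}.FullSubcategory ≌ CaTT.isOneObjectModel.{w}.FullSubcategory,
      e.functor ⋙ CaTT.isOneObjectModel.{w}.ι =
        MCaTT.isModel.{w}.ι ⋙ (Functor.whiskeringLeft _ _ _).obj desuspension ∧
      e.inverse ⋙ MCaTT.isModel.{w}.ι =
        CaTT.isOneObjectModel.{w}.ι ⋙ (Functor.whiskeringLeft _ _ _).obj reducedSuspension :=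
  ⟨CategoryTheory.Equivalence.mk desuspensionPullback reducedSuspensionPullback unitIso counitIso, rfl, rfl⟩
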